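/- Work in \emph{synthetic computability}: intuitionistic higher-order logic with a type $\mathbb N$ of natural numbers (Peano axioms with full induction), a type $\Omega$ of truth values, product and function types, function and propositional extensionality and unique choice, extended by the following axioms. Here $\Sigma=\{p\in\Omega \mid \exists f\in 2^{\mathbb N}\,(p\Leftrightarrow\exists n\in\mathbb N,\ f(n)=1)\}$ is the set of semidecidable truth values, and for a set $X$ the elements of $\Sigma^X$ are the semidecidable subsets of $X$. (1) Dependent Choice: if $X$ is a subset of a type, $R$ is a relation with $\forall x\in X\,\exists y\in X\,R(x,y)$, and $a\in X$, then there is $f:\mathbb N\to X$ with $f(0)=a$ and $R(f(n),f(n+1))$ for all $n$. (2) Markov Principle: a binary sequence whose terms are not all $0$ contains a $1$. (3) Enumerability Axiom: there is a surjection $W:\mathbb N\to\Sigma^{\mathbb N}$. (4) Stable Subspace Axiom: if $X\subseteq\mathbb N$ satisfies $\neg\neg(n\in X)\Rightarrow n\in X$ for all $n$, then every $S\in\Sigma^X$ is the restriction to $X$ of some $S'\in\Sigma^{\mathbb N}$. The intrinsic topology of $\Sigma^{\mathbb N}$ is $\Sigma^{\Sigma^{\mathbb N}}$, i.e. its open sets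 are the semidecidable subsets. Order $\Sigma^{\mathbb N}$ by inclusion. A subset $U\subseteq\Sigma^{\mathbb N}$ is \emph{Scott-open} if it is semidecidable, upward closed, and whenever $c_0\subseteq c_1\subseteq\cdots$ is a chain in $\Sigma^{\mathbb N}$ whose supremum exists and lies in $U$, then $c_m\in U$ for some $m$. For a finite $T\subseteq\mathbb N$ let ${\uparrow}T=\{S\in\Sigma^{\mathbb N}\mid T\subseteq S\}$. \textbf{Proposition.} It is derivable in synthetic computability that the intrinsic topology of $\Sigma^{\mathbb N}$ is the Scott topology. That is, for every subset $U\subseteq\Sigma^{\mathbb N}$ the following are equivalent: (a) $U$ is semidecidable; (b) $U$ is Scott-open; (c) $U$ is a countable union of basic open sets, i.e. there are a semidecidable $I\subseteq\mathbb N$ and finite sets $T_n\subseteq\mathbb N$ ($n\in I$) with $U=\bigcup_{n\in I}{\uparrow}T_n$. Moreover, if $U$ is semidecidable then, for every $S\in\Sigma^{\mathbb N}$, $$S\in U\iff \exists\, T\subseteq S\ (T\text{ finite and } T\in U),$$ so $U$ is the union of the basic open sets ${\uparrow}T$ with $T\in U$ finite. -/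

import Mathlib

/-! Intuitionistic higher-order logic (the internal language of a topos with a natural numbers
object) as a formal system, the axioms of synthetic computability in it, and the notions needed to
speak about the intrinsic topology and the Scott topology of `Σ^ℕ`.  The axioms refute excluded
middle, so "holds in synthetic computability" is rendered as derivability. -/

namespace SynthComp

/-! ### Types, terms and formulas -/

/-- Types: natural numbers, truth values, products, function types.  `A ⟶ₜ Ω` is the power type. -/
inductive Ty : Type
  | nat : Ty
  | omega : Ty
  | prod : Ty → Ty → Ty
  | arr : Ty → Ty → Ty

infixr:70 " ⟶ₜ " => Ty.arr

/-- Contexts; the most recently bound variable comes first. -/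
abbrev Ctx : Type := List Ty

/-- Typed de Bruijn variables. -/
inductive Var : Ctx → Ty → Type
  | z {Γ : Ctx} {A : Ty} : Var (A :: Γ) A
  | s {Γ : Ctx} {A B : Ty} : Var Γ A → Var (B :: Γ) A

/-- Terms `t : A` in context `Γ`.  The terms of type `omega` are the formulas. -/
inductive Tm : Ctx → Ty → Type
  | var {Γ : Ctx} {A : Ty} : Var Γ A → Tm Γ A
  | app {Γ : Ctx} {A B : Ty} : Tm Γ (A ⟶ₜ B) → Tm Γ A → Tm Γ B
  | lam {Γ : Ctx} {A B : Ty} : Tm (A :: Γ) B → Tm Γ (A ⟶ₜ B)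
  | pair {Γ : Ctx} {A B : Ty} : Tm Γ A → Tm Γ B → Tm Γ (Ty.prod A B)
  | fst {Γ : Ctx} {A B : Ty} : Tm Γ (Ty.prod A B) → Tm Γ A
  | snd {Γ : Ctx} {A B : Ty} : Tm Γ (Ty.prod A B) → Tm Γ B
  | zero {Γ : Ctx} : Tm Γ Ty.nat
  | succ {Γ : Ctx} : Tm Γ Ty.nat → Tm Γ Ty.nat
  | eq {Γ : Ctx} {A : Ty} : Tm Γ A → Tm Γ A → Tm Γ Ty.omega
  | bot {Γ : Ctx} : Tm Γ Ty.omega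
  | and {Γ : Ctx} : Tm Γ Ty.omega → Tm Γ Ty.omega → Tm Γ Ty.omega
  | or {Γ : Ctx} : Tm Γ Ty.omega → Tm Γ Ty.omega → Tm Γ Ty.omega
  | imp {Γ : Ctx} : Tm Γ Ty.omega → Tm Γ Ty.omega → Tm Γ Ty.omega
  | all {Γ : Ctx} (A : Ty) : Tm (A :: Γ) Ty.omega → Tm Γ Ty.omega
  | ex {Γ : Ctx} (A : Ty) : Tm (A :: Γ) Ty.omega → Tm Γ Ty.omega

abbrev Fm (Γ : Ctx) : Type := Tm Γ Ty.omega

infixl:100 " ⬝ₜ " => Tm.app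
infix:65 " ≐ₜ " => Tm.eq
infixr:60 " ⊓ₜ " => Tm.and
infixr:55 " ⊔ₜ " => Tm.or
infixr:50 " ⇒ₜ " => Tm.imp

def neg {Γ : Ctx} (p : Fm Γ) : Fm Γ := p ⇒ₜ Tm.bot

def iff {Γ : Ctx} (p q : Fm Γ) : Fm Γ := (p ⇒ₜ q) ⊓ₜ (q ⇒ₜ p)

infix:45 " ⇔ₜ " => SynthComp.iff

/-! ### Renaming and substitution -/

abbrev Ren (Γ Δ : Ctx) : Type := (A : Ty) → Var Γ A → Var Δ A

def Ren.lift {Γ Δ : Ctx} (ρ : Ren Γ Δ) (B : Ty) : Ren (B :: Γ) (B :: Δ)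
  | _, Var.z => Var.z
  | _, Var.s x => Var.s (ρ _ x)

def Tm.rename : {Γ : Ctx} → {A : Ty} → Tm Γ A → {Δ : Ctx} → Ren Γ Δ → Tm Δ A
  | _, _, .var x, _, ρ => .var (ρ _ x)
  | _, _, .app t u, _, ρ => .app (t.rename ρ) (u.rename ρ)
  | _, _, .lam t, _, ρ => .lam (t.rename (ρ.lift _))
  | _, _, .pair t u, _, ρ => .pair (t.rename ρ) (u.rename ρ)
  | _, _, .fst t, _, ρ => .fst (t.rename ρ)
  | _, _, .snd t, _, ρ => .snd (t.rename ρ)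
  | _, _, .zero, _, _ => .zero
  | _, _, .succ t, _, ρ => .succ (t.rename ρ)
  | _, _, .eq t u, _, ρ => .eq (t.rename ρ) (u.rename ρ)
  | _, _, .bot, _, _ => .bot
  | _, _, .and p q, _, ρ => .and (p.rename ρ) (q.rename ρ)
  | _, _, .or p q, _, ρ => .or (p.rename ρ) (q.rename ρ)
  | _, _, .imp p q, _, ρ => .imp (p.rename ρ) (q.rename ρ)
  | _, _, .all A p, _, ρ => .all A (p.rename (ρ.lift _))
  | _, _, .ex A p, _, ρ => .ex A (p.rename (ρ.lift _))

/-- Weakening by one variable. -/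
def Tm.wk {Γ : Ctx} {A B : Ty} (t : Tm Γ A) : Tm (B :: Γ) A := t.rename (fun _ x => Var.s x)

/-- A closed term in an arbitrary context. -/
def Tm.closed {Γ : Ctx} {A : Ty} (t : Tm [] A) : Tm Γ A := t.rename (fun _ x => nomatch x)

abbrev Sub (Γ Δ : Ctx) : Type := (A : Ty) → Var Γ A → Tm Δ A

def Sub.lift {Γ Δ : Ctx} (σ : Sub Γ Δ) (B : Ty) : Sub (B :: Γ) (B :: Δ)
  | _, Var.z => Tm.var Var.z
  | _, Var.s x => (σ _ x).wk

/-- Simultaneous capture-avoiding substitution. -/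
def Tm.subst : {Γ : Ctx} → {A : Ty} → Tm Γ A → {Δ : Ctx} → Sub Γ Δ → Tm Δ A
  | _, _, .var x, _, σ => σ _ x
  | _, _, .app t u, _, σ => .app (t.subst σ) (u.subst σ)
  | _, _, .lam t, _, σ => .lam (t.subst (σ.lift _))
  | _, _, .pair t u, _, σ => .pair (t.subst σ) (u.subst σ)
  | _, _, .fst t, _, σ => .fst (t.subst σ)
  | _, _, .snd t, _, σ => .snd (t.subst σ)
  | _, _, .zero, _, _ => .zero
  | _, _, .succ t, _, σ => .succ (t.subst σ)
  | _, _, .eq t u, _, σ => .eq (t.subst σ) (u.subst σ)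
  | _, _, .bot, _, _ => .bot
  | _, _, .and p q, _, σ => .and (p.subst σ) (q.subst σ)
  | _, _, .or p q, _, σ => .or (p.subst σ) (q.subst σ)
  | _, _, .imp p q, _, σ => .imp (p.subst σ) (q.subst σ)
  | _, _, .all A p, _, σ => .all A (p.subst (σ.lift _))
  | _, _, .ex A p, _, σ => .ex A (p.subst (σ.lift _))

/-- `x₀ ↦ a`, other variables unchanged. -/
def Sub.one {Γ : Ctx} {B : Ty} (a : Tm Γ B) : Sub (B :: Γ) Γ
  | _, Var.z => a
  | _, Var.s x => Tm.var x

/-- `t[a]`: replace the most recent variable of `t` by `a`. -/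
def Tm.inst {Γ : Ctx} {A B : Ty} (t : Tm (B :: Γ) A) (a : Tm Γ B) : Tm Γ A := t.subst (Sub.one a)

/-- `x₀ ↦ x₀ + 1`, other variables unchanged. -/
def Sub.bump {Γ : Ctx} : Sub (Ty.nat :: Γ) (Ty.nat :: Γ)
  | _, Var.z => Tm.succ (Tm.var Var.z)
  | _, Var.s x => Tm.var (Var.s x)

abbrev v0 {Γ : Ctx} {A : Ty} : Tm (A :: Γ) A := Tm.var Var.z
abbrev v1 {Γ : Ctx} {A B : Ty} : Tm (B :: A :: Γ) A := Tm.var (Var.s Var.z)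
abbrev v2 {Γ : Ctx} {A B C : Ty} : Tm (C :: B :: A :: Γ) A := Tm.var (Var.s (Var.s Var.z))
abbrev v3 {Γ : Ctx} {A B C D : Ty} : Tm (D :: C :: B :: A :: Γ) A :=
  Tm.var (Var.s (Var.s (Var.s Var.z)))

/-! ### Derivability -/

/-- `Derives T Δ φ`: the formula `φ` is derivable from the hypotheses `Δ` (both in context `Γ`) and
the closed axioms `T` in intuitionistic higher-order logic: natural deduction with equality,
function extensionality, propositional extensionality, surjective pairing, Peano axioms with full
induction, and unique choice (a total single-valued relation is the graph of a function). -/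
inductive Derives (T : Set (Fm [])) : {Γ : Ctx} → List (Fm Γ) → Fm Γ → Prop
  | ax {Γ : Ctx} {Δ : List (Fm Γ)} {φ : Fm []} : φ ∈ T → Derives T Δ φ.closed
  | hyp {Γ : Ctx} {Δ : List (Fm Γ)} {φ : Fm Γ} : φ ∈ Δ → Derives T Δ φ
  | botE {Γ : Ctx} {Δ : List (Fm Γ)} {φ : Fm Γ} : Derives T Δ Tm.bot → Derives T Δ φ
  | andI {Γ : Ctx} {Δ : List (Fm Γ)} {φ ψ : Fm Γ} :
      Derives T Δ φ → Derives T Δ ψ → Derives T Δ (φ ⊓ₜ ψ)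
  | andE₁ {Γ : Ctx} {Δ : List (Fm Γ)} {φ ψ : Fm Γ} : Derives T Δ (φ ⊓ₜ ψ) → Derives T Δ φ
  | andE₂ {Γ : Ctx} {Δ : List (Fm Γ)} {φ ψ : Fm Γ} : Derives T Δ (φ ⊓ₜ ψ) → Derives T Δ ψ
  | orI₁ {Γ : Ctx} {Δ : List (Fm Γ)} {φ ψ : Fm Γ} : Derives T Δ φ → Derives T Δ (φ ⊔ₜ ψ)
  | orI₂ {Γ : Ctx} {Δ : List (Fm Γ)} {φ ψ : Fm Γ} : Derives T Δ ψ → Derives T Δ (φ ⊔ₜ ψ)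
  | orE {Γ : Ctx} {Δ : List (Fm Γ)} {φ ψ χ : Fm Γ} :
      Derives T Δ (φ ⊔ₜ ψ) → Derives T (φ :: Δ) χ → Derives T (ψ :: Δ) χ → Derives T Δ χ
  | impI {Γ : Ctx} {Δ : List (Fm Γ)} {φ ψ : Fm Γ} :
      Derives T (φ :: Δ) ψ → Derives T Δ (φ ⇒ₜ ψ)
  | impE {Γ : Ctx} {Δ : List (Fm Γ)} {φ ψ : Fm Γ} :
      Derives T Δ (φ ⇒ₜ ψ) → Derives T Δ φ → Derives T Δ ψ
  | allI {Γ : Ctx} {Δ : List (Fm Γ)} {A : Ty} {φ : Fm (A :: Γ)} :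
      Derives T (Δ.map Tm.wk) φ → Derives T Δ (Tm.all A φ)
  | allE {Γ : Ctx} {Δ : List (Fm Γ)} {A : Ty} {φ : Fm (A :: Γ)} (a : Tm Γ A) :
      Derives T Δ (Tm.all A φ) → Derives T Δ (φ.inst a)
  | exI {Γ : Ctx} {Δ : List (Fm Γ)} {A : Ty} {φ : Fm (A :: Γ)} (a : Tm Γ A) :
      Derives T Δ (φ.inst a) → Derives T Δ (Tm.ex A φ)
  | exE {Γ : Ctx} {Δ : List (Fm Γ)} {A : Ty} {φ : Fm (A :: Γ)} {ψ : Fm Γ} :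
      Derives T Δ (Tm.ex A φ) → Derives T (φ :: Δ.map Tm.wk) ψ.wk → Derives T Δ ψ
  | eqI {Γ : Ctx} {Δ : List (Fm Γ)} {A : Ty} (a : Tm Γ A) : Derives T Δ (a ≐ₜ a)
  | eqE {Γ : Ctx} {Δ : List (Fm Γ)} {A : Ty} {a b : Tm Γ A} (φ : Fm (A :: Γ)) :
      Derives T Δ (a ≐ₜ b) → Derives T Δ (φ.inst a) → Derives T Δ (φ.inst b)
  | beta {Γ : Ctx} {Δ : List (Fm Γ)} {A B : Ty} (t : Tm (A :: Γ) B) (a : Tm Γ A) :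
      Derives T Δ (Tm.lam t ⬝ₜ a ≐ₜ t.inst a)
  | fnext {Γ : Ctx} {Δ : List (Fm Γ)} {A B : Ty} {f g : Tm Γ (A ⟶ₜ B)} :
      Derives T Δ (Tm.all A (f.wk ⬝ₜ v0 ≐ₜ g.wk ⬝ₜ v0)) → Derives T Δ (f ≐ₜ g)
  | prext {Γ : Ctx} {Δ : List (Fm Γ)} {p q : Fm Γ} :
      Derives T Δ (p ⇔ₜ q) → Derives T Δ (p ≐ₜ q)
  | fst_pair {Γ : Ctx} {Δ : List (Fm Γ)} {A B : Ty} (a : Tm Γ A) (b : Tm Γ B) :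
      Derives T Δ (Tm.fst (Tm.pair a b) ≐ₜ a)
  | snd_pair {Γ : Ctx} {Δ : List (Fm Γ)} {A B : Ty} (a : Tm Γ A) (b : Tm Γ B) :
      Derives T Δ (Tm.snd (Tm.pair a b) ≐ₜ b)
  | pair_eta {Γ : Ctx} {Δ : List (Fm Γ)} {A B : Ty} (c : Tm Γ (Ty.prod A B)) :
      Derives T Δ (Tm.pair (Tm.fst c) (Tm.snd c) ≐ₜ c)
  | succ_ne_zero {Γ : Ctx} {Δ : List (Fm Γ)} (n : Tm Γ Ty.nat) :
      Derives T Δ (neg (Tm.succ n ≐ₜ Tm.zero))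
  | succ_inj {Γ : Ctx} {Δ : List (Fm Γ)} {m n : Tm Γ Ty.nat} :
      Derives T Δ (Tm.succ m ≐ₜ Tm.succ n) → Derives T Δ (m ≐ₜ n)
  | induct {Γ : Ctx} {Δ : List (Fm Γ)} (φ : Fm (Ty.nat :: Γ)) :
      Derives T Δ (φ.inst Tm.zero) →
      Derives T Δ (Tm.all Ty.nat (φ ⇒ₜ φ.subst Sub.bump)) →
      Derives T Δ (Tm.all Ty.nat φ)
  | unique_choice {Γ : Ctx} {Δ : List (Fm Γ)} {A B : Ty} (R : Tm Γ (A ⟶ₜ B ⟶ₜ Ty.omega)) :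
      Derives T Δ (Tm.all A (Tm.ex B (R.wk.wk ⬝ₜ v1 ⬝ₜ v0))) →
      Derives T Δ (Tm.all A (Tm.all B (Tm.all B
        (R.wk.wk.wk ⬝ₜ v2 ⬝ₜ v1 ⇒ₜ R.wk.wk.wk ⬝ₜ v2 ⬝ₜ v0 ⇒ₜ v1 ≐ₜ v0)))) →
      Derives T Δ (Tm.ex (A ⟶ₜ B) (Tm.all A (R.wk.wk ⬝ₜ v0 ⬝ₜ (v1 ⬝ₜ v0))))

/-! ### Semidecidability and the axioms of synthetic computability -/

/-- Subsets of `ℕ`. -/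
abbrev PN : Ty := Ty.nat ⟶ₜ Ty.omega

/-- `f` is a binary sequence, `f ∈ 2^ℕ`. -/
def isBinary {Γ : Ctx} (f : Tm Γ (Ty.nat ⟶ₜ Ty.nat)) : Fm Γ :=
  Tm.all Ty.nat ((f.wk ⬝ₜ v0 ≐ₜ Tm.zero) ⊔ₜ (f.wk ⬝ₜ v0 ≐ₜ Tm.succ Tm.zero))

/-- `∃ n, f n = 1` -/
def hasOne {Γ : Ctx} (f : Tm Γ (Ty.nat ⟶ₜ Ty.nat)) : Fm Γ :=
  Tm.ex Ty.nat (f.wk ⬝ₜ v0 ≐ₜ Tm.succ Tm.zero)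

/-- `p ∈ Σ` (the Rosolini dominance): `∃ f ∈ 2^ℕ, p ⇔ ∃ n, f n = 1` -/
def inSigma {Γ : Ctx} (p : Fm Γ) : Fm Γ :=
  Tm.ex (Ty.nat ⟶ₜ Ty.nat) (isBinary v0 ⊓ₜ (p.wk ⇔ₜ hasOne v0))

/-- `S ∈ Σ^ℕ`: the subset `S` of `ℕ` is semidecidable. -/
def inSigmaN {Γ : Ctx} (S : Tm Γ PN) : Fm Γ := Tm.all Ty.nat (inSigma (S.wk ⬝ₜ v0))

/-- `S ⊆ S'` -/
def subset {Γ : Ctx} (S S' : Tm Γ PN) : Fm Γ := Tm.all Ty.nat (S.wk ⬝ₜ v0 ⇒ₜ S'.wk ⬝ₜ v0)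

/-- Dependent choice for the subsets of `A`: for `X ⊆ A`, a relation `R` that is total on `X` and
`a ∈ X`, there is `f : ℕ → X` with `f 0 = a` and `R (f n) (f (n + 1))` for all `n`. -/
def dependentChoice (A : Ty) : Fm [] :=
  Tm.all (A ⟶ₜ Ty.omega) <| Tm.all (A ⟶ₜ A ⟶ₜ Ty.omega) <|
    Tm.all A (v2 ⬝ₜ v0 ⇒ₜ Tm.ex A (v3 ⬝ₜ v0 ⊓ₜ v2 ⬝ₜ v1 ⬝ₜ v0)) ⇒ₜ
    Tm.all A (v2 ⬝ₜ v0 ⇒ₜ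
      Tm.ex (Ty.nat ⟶ₜ A) ((v0 ⬝ₜ Tm.zero ≐ₜ v1) ⊓ₜ
        Tm.all Ty.nat
          (Tm.var (Var.s (Var.s (Var.s (Var.s Var.z)))) ⬝ₜ (v1 ⬝ₜ v0) ⊓ₜ
            v3 ⬝ₜ (v1 ⬝ₜ v0) ⬝ₜ (v1 ⬝ₜ Tm.succ v0))))

/-- If not all terms of a binary sequence are zero, then the sequence contains a one. -/
def markov : Fm [] :=
  Tm.all (Ty.nat ⟶ₜ Ty.nat)
    (isBinary v0 ⇒ₜ neg (Tm.all Ty.nat (v1 ⬝ₜ v0 ≐ₜ Tm.zero)) ⇒ₜ hasOne v0)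

/-- There is a surjection `W : ℕ → Σ^ℕ`. -/
def enumerability : Fm [] :=
  Tm.ex (Ty.nat ⟶ₜ PN)
    (Tm.all Ty.nat (inSigmaN (v1 ⬝ₜ v0)) ⊓ₜ
      Tm.all PN (inSigmaN v0 ⇒ₜ Tm.ex Ty.nat (v2 ⬝ₜ v0 ≐ₜ v1)))

/-- For every `¬¬`-stable `X ⊆ ℕ`, every `S ∈ Σ^X` is the restriction of some `S' ∈ Σ^ℕ`. -/
def stableSubspace : Fm [] :=
  Tm.all PN <|
    Tm.all Ty.nat (neg (neg (v1 ⬝ₜ v0)) ⇒ₜ v1 ⬝ₜ v0) ⇒ₜ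
    Tm.all PN (Tm.all Ty.nat (v2 ⬝ₜ v0 ⇒ₜ inSigma (v1 ⬝ₜ v0)) ⇒ₜ
      Tm.ex PN (inSigmaN v0 ⊓ₜ
        Tm.all Ty.nat (v3 ⬝ₜ v0 ⇒ₜ (v2 ⬝ₜ v0 ⇔ₜ v1 ⬝ₜ v0))))

/-- The axioms of synthetic computability. -/
inductive SynthAx : Set (Fm [])
  | dependentChoice (A : Ty) : SynthAx (dependentChoice A)
  | markov : SynthAx markov
  | enumerability : SynthAx enumerability
  | stableSubspace : SynthAx stableSubspace

/-- The sentence `φ` holds in synthetic computability. -/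
def Holds (φ : Fm []) : Prop := Derives SynthAx [] φ

/-! ### Topologies on `Σ^ℕ`

A subset of `Σ^ℕ` is given by a predicate `U` on `PN`, of which only the values on `Σ^ℕ` matter. -/

/-- Families of subsets of `ℕ`. -/
abbrev PPN : Ty := PN ⟶ₜ Ty.omega

/-- `U ∈ Σ^(Σ^ℕ)`: `U` is a semidecidable subset of `Σ^ℕ`, i.e. open in the intrinsic topology. -/
def intrinsicOpen {Γ : Ctx} (U : Tm Γ PPN) : Fm Γ :=
  Tm.all PN (inSigmaN v0 ⇒ₜ inSigma (U.wk ⬝ₜ v0))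

/-- `c` is a chain in `(Σ^ℕ, ⊆)`. -/
def isChain {Γ : Ctx} (c : Tm Γ (Ty.nat ⟶ₜ PN)) : Fm Γ :=
  Tm.all Ty.nat (inSigmaN (c.wk ⬝ₜ v0)) ⊓ₜ
    Tm.all Ty.nat (subset (c.wk ⬝ₜ v0) (c.wk ⬝ₜ Tm.succ v0))

/-- `S` is the supremum of `c` in `(Σ^ℕ, ⊆)`. -/
def isSup {Γ : Ctx} (c : Tm Γ (Ty.nat ⟶ₜ PN)) (S : Tm Γ PN) : Fm Γ :=
  inSigmaN S ⊓ₜ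
    Tm.all Ty.nat (subset (c.wk ⬝ₜ v0) S.wk) ⊓ₜ
    Tm.all PN (inSigmaN v0 ⇒ₜ
      Tm.all Ty.nat (subset (c.wk.wk ⬝ₜ v0) v1) ⇒ₜ subset S.wk v0)

/-- `U` is Scott-open in the ω-cpo `(Σ^ℕ, ⊆)`: it is semidecidable, upward closed and inaccessible
by suprema of chains. -/
def scottOpen {Γ : Ctx} (U : Tm Γ PPN) : Fm Γ :=
  intrinsicOpen U ⊓ₜ
    Tm.all PN (Tm.all PN (inSigmaN v1 ⇒ₜ inSigmaN v0 ⇒ₜ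
      U.wk.wk ⬝ₜ v1 ⇒ₜ subset v1 v0 ⇒ₜ U.wk.wk ⬝ₜ v0)) ⊓ₜ
    Tm.all (Ty.nat ⟶ₜ PN) (Tm.all PN (isChain v1 ⇒ₜ isSup v1 v0 ⇒ₜ
      U.wk.wk ⬝ₜ v0 ⇒ₜ Tm.ex Ty.nat (U.wk.wk.wk ⬝ₜ (v2 ⬝ₜ v0))))

/-- `∅` -/
def emptySet {Γ : Ctx} : Tm Γ PN := Tm.lam Tm.bot

/-- `S ∪ {n}` -/
def insert {Γ : Ctx} (S : Tm Γ PN) (n : Tm Γ Ty.nat) : Tm Γ PN :=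
  Tm.lam ((S.wk ⬝ₜ v0) ⊔ₜ (v0 ≐ₜ n.wk))

/-- `S` is finite: it belongs to every family of subsets of `ℕ` that contains `∅` and is closed
under adding one element. -/
def isFinite {Γ : Ctx} (S : Tm Γ PN) : Fm Γ :=
  Tm.all PPN (v0 ⬝ₜ emptySet ⇒ₜ
    Tm.all PN (Tm.all Ty.nat (v2 ⬝ₜ v1 ⇒ₜ v2 ⬝ₜ insert v1 v0)) ⇒ₜ v0 ⬝ₜ S.wk)

/-- `U` is a countable union of basic sets `↑F = {S ∈ Σ^ℕ | F ⊆ S}` with `F ⊆ ℕ` finite: there are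
`I ∈ Σ^ℕ` and finite sets `F n`, for `n ∈ I`, such that `S ∈ U ⇔ ∃ n ∈ I, F n ⊆ S`. -/
def countableUnionOfBasic {Γ : Ctx} (U : Tm Γ PPN) : Fm Γ :=
  Tm.ex PN (Tm.ex (Ty.nat ⟶ₜ PN)
    (inSigmaN v1 ⊓ₜ
      Tm.all Ty.nat (v2 ⬝ₜ v0 ⇒ₜ isFinite (v1 ⬝ₜ v0)) ⊓ₜ
      Tm.all PN (inSigmaN v0 ⇒ₜ
        (U.wk.wk.wk ⬝ₜ v0 ⇔ₜ Tm.ex Ty.nat (v3 ⬝ₜ v0 ⊓ₜ subset (v2 ⬝ₜ v0) v1)))))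

/-- `S ∈ U ⇔ ∃ F ⊆ S, F finite ∧ F ∈ U`, for all `S ∈ Σ^ℕ`; in other words, `U` is the union of the
`↑F` with `F ∈ U` finite. -/
def unionOfItsBasic {Γ : Ctx} (U : Tm Γ PPN) : Fm Γ :=
  Tm.all PN (inSigmaN v0 ⇒ₜ
    (U.wk ⬝ₜ v0 ⇔ₜ Tm.ex PN (isFinite v0 ⊓ₜ subset v0 v1 ⊓ₜ U.wk.wk ⬝ₜ v0)))

/-- For every `U ⊆ Σ^ℕ`: `U` is semidecidable iff it is Scott-open, iff it is a countable union of
basic sets `↑F`; and every semidecidable `U` is the union of the `↑F` with `F ∈ U` finite. -/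
def intrinsicIsScott : Fm [] :=
  Tm.all PPN
    ((intrinsicOpen v0 ⇔ₜ scottOpen v0) ⊓ₜ
      (intrinsicOpen v0 ⇔ₜ countableUnionOfBasic v0) ⊓ₜ
      (intrinsicOpen v0 ⇒ₜ unionOfItsBasic v0))

end SynthComp

namespace SynthComp

/-! ### Renaming and substitution of terms -/

/-! The engine is a diagonal argument: semidecidable truth values are not closed under negation.
Otherwise `{n | n ∉ W n}` would be semidecidable for an enumeration `W` of `Σ^ℕ`, hence equal to
some `W k`, and `k ∈ W k` would contradict itself. By Markov's principle semidecidable truth values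
are `¬¬`-stable, so a semidecidable conclusion may be proved by showing that its failure would make
`¬p` semidecidable for every semidecidable `p`.

This is applied twice to a semidecidable `U`. For upward closure (`intrinsicOpen_upper`), let `S ⊆
T`, `S ∈ U`, `T ∉ U`. The set `S ∪ {n ∈ T | p}` is `T` if `p` and `S` if `¬p`, so it lies in `U`
exactly when `¬p`. For inaccessibility (`intrinsicOpen_chain`), let `S ∈ U` be contained in the
union of a chain `c` with no term in `U`, and let `g` be a binary sequence that attains one exactly
when `p`. The set of the `n` that lie in some `c k` with `g` vanishing below `k` is contained in a
single `c m` if `p`, and contains `S` if `¬p`; so again it lies in `U` exactly when `¬p`.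

Every `S ∈ Σ^ℕ` is the union of a chain of finite stages (`approx`), obtained by dovetailing the
searches for its elements. Hence `S ∈ U` iff some finite subset of `S` lies in `U`. Listing all
stages of all `W n` and keeping those in `U` gives the countable union of basic sets. Conversely,
such a union is semidecidable because inclusion of a finite set is, and because `Σ` is a dominance
closed under countable unions.

The derivations are not written with de Bruijn indices. Terms receive parameters, and `w ⊩ φ` says
that `φ` follows from the hypotheses `w` under every interpretation of the parameters. Binders then
become quantification over closed terms in Lean, justified by fresh parameters (`Pr.allI`,
`Pr.exE`), and weakening is left to instance search. -/

theorem Ren.lift_comp {Γ Δ Θ : Ctx} (ρ : Ren Γ Δ) (τ : Ren Δ Θ) (B : Ty) :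
    (fun A x => τ.lift B A (ρ.lift B A x)) = Ren.lift (fun A x => τ A (ρ A x)) B := by
  funext A x; cases x <;> rfl

namespace Tm

theorem rename_rename {Γ : Ctx} {A : Ty} (t : Tm Γ A) : ∀ {Δ Θ : Ctx} (ρ : Ren Γ Δ) (τ : Ren Δ Θ),
    (t.rename ρ).rename τ = t.rename (fun A x => τ A (ρ A x)) := by
  induction t <;> intros <;> simp only [rename, Ren.lift_comp, *]

theorem subst_rename {Γ : Ctx} {A : Ty} (t : Tm Γ A) : ∀ {Δ Θ : Ctx} (ρ : Ren Γ Δ) (σ : Sub Δ Θ),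
    (t.rename ρ).subst σ = t.subst (fun A x => σ A (ρ A x)) := by
  have key : ∀ {Γ Δ Θ : Ctx} (ρ : Ren Γ Δ) (σ : Sub Δ Θ) (B : Ty),
      (fun A x => σ.lift B A (ρ.lift B A x)) = Sub.lift (fun A x => σ A (ρ A x)) B := by
    intros; funext A x; cases x <;> rfl
  induction t <;> intros <;> simp only [rename, subst, *]

theorem rename_subst {Γ : Ctx} {A : Ty} (t : Tm Γ A) : ∀ {Δ Θ : Ctx} (σ : Sub Γ Δ) (ρ : Ren Δ Θ),
    (t.subst σ).rename ρ = t.subst (fun A x => (σ A x).rename ρ) := by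
  have key : ∀ {Γ Δ Θ : Ctx} (σ : Sub Γ Δ) (ρ : Ren Δ Θ) (B : Ty),
      (fun A x => (σ.lift B A x).rename (ρ.lift B)) = Sub.lift (fun A x => (σ A x).rename ρ) B := by
    intros; funext A x; cases x
    · rfl
    · simp [Sub.lift, wk, rename_rename]; rfl
  induction t <;> intros <;> simp only [rename, subst, *]

theorem subst_var {Γ : Ctx} {A : Ty} (t : Tm Γ A) : t.subst (fun _ x => Tm.var x) = t := by
  have key : ∀ {Γ : Ctx} (B : Ty), Sub.lift (fun A (x : Var Γ A) => Tm.var x) B = fun _ x => Tm.var x := by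
    intros; funext A x; cases x <;> rfl
  induction t <;> simp only [subst, *]

theorem wk_subst_lift {Γ Δ : Ctx} {A B : Ty} (t : Tm Γ A) (σ : Sub Γ Δ) :
    (t.wk (B := B)).subst (σ.lift B) = (t.subst σ).wk := by
  simp only [wk, subst_rename, rename_subst]; rfl

theorem wk_subst_one {Γ : Ctx} {A B : Ty} (t : Tm Γ A) (a : Tm Γ B) :
    t.wk.subst (Sub.one a) = t := by
  simp only [wk, subst_rename]; exact subst_var t

end Tm

/-! ### Terms with parameters -/

/-- Terms that may contain parameters `par n A`, an unlimited supply of constants of each type. -/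
inductive PTm : Ctx → Ty → Type
  | par {Γ : Ctx} (n : ℕ) (A : Ty) : PTm Γ A
  | var {Γ : Ctx} {A : Ty} : Var Γ A → PTm Γ A
  | app {Γ : Ctx} {A B : Ty} : PTm Γ (A ⟶ₜ B) → PTm Γ A → PTm Γ B
  | lam {Γ : Ctx} {A B : Ty} : PTm (A :: Γ) B → PTm Γ (A ⟶ₜ B)
  | pair {Γ : Ctx} {A B : Ty} : PTm Γ A → PTm Γ B → PTm Γ (Ty.prod A B)
  | fst {Γ : Ctx} {A B : Ty} : PTm Γ (Ty.prod A B) → PTm Γ A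
  | snd {Γ : Ctx} {A B : Ty} : PTm Γ (Ty.prod A B) → PTm Γ B
  | zero {Γ : Ctx} : PTm Γ Ty.nat
  | succ {Γ : Ctx} : PTm Γ Ty.nat → PTm Γ Ty.nat
  | eq {Γ : Ctx} {A : Ty} : PTm Γ A → PTm Γ A → PTm Γ Ty.omega
  | bot {Γ : Ctx} : PTm Γ Ty.omega
  | and {Γ : Ctx} : PTm Γ Ty.omega → PTm Γ Ty.omega → PTm Γ Ty.omega
  | or {Γ : Ctx} : PTm Γ Ty.omega → PTm Γ Ty.omega → PTm Γ Ty.omega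
  | imp {Γ : Ctx} : PTm Γ Ty.omega → PTm Γ Ty.omega → PTm Γ Ty.omega
  | all {Γ : Ctx} (A : Ty) : PTm (A :: Γ) Ty.omega → PTm Γ Ty.omega
  | ex {Γ : Ctx} (A : Ty) : PTm (A :: Γ) Ty.omega → PTm Γ Ty.omega

abbrev PFm (Γ : Ctx) : Type := PTm Γ Ty.omega

infixl:100 " ⬝ₚ " => PTm.app
infix:65 " ≐ₚ " => PTm.eq
infixr:60 " ⊓ₚ " => PTm.and
infixr:55 " ⊔ₚ " => PTm.or
infixr:50 " ⇒ₚ " => PTm.imp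

namespace PTm

def rename : {Γ : Ctx} → {A : Ty} → PTm Γ A → {Δ : Ctx} → Ren Γ Δ → PTm Δ A
  | _, _, .par n A, _, _ => .par n A
  | _, _, .var x, _, ρ => .var (ρ _ x)
  | _, _, .app t u, _, ρ => .app (t.rename ρ) (u.rename ρ)
  | _, _, .lam t, _, ρ => .lam (t.rename (ρ.lift _))
  | _, _, .pair t u, _, ρ => .pair (t.rename ρ) (u.rename ρ)
  | _, _, .fst t, _, ρ => .fst (t.rename ρ)
  | _, _, .snd t, _, ρ => .snd (t.rename ρ)
  | _, _, .zero, _, _ => .zero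
  | _, _, .succ t, _, ρ => .succ (t.rename ρ)
  | _, _, .eq t u, _, ρ => .eq (t.rename ρ) (u.rename ρ)
  | _, _, .bot, _, _ => .bot
  | _, _, .and p q, _, ρ => .and (p.rename ρ) (q.rename ρ)
  | _, _, .or p q, _, ρ => .or (p.rename ρ) (q.rename ρ)
  | _, _, .imp p q, _, ρ => .imp (p.rename ρ) (q.rename ρ)
  | _, _, .all A p, _, ρ => .all A (p.rename (ρ.lift _))
  | _, _, .ex A p, _, ρ => .ex A (p.rename (ρ.lift _))

def wk {Γ : Ctx} {A B : Ty} (t : PTm Γ A) : PTm (B :: Γ) A := t.rename (fun _ x => Var.s x)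

end PTm

abbrev PSub (Γ Δ : Ctx) : Type := (A : Ty) → Var Γ A → PTm Δ A

def PSub.lift {Γ Δ : Ctx} (σ : PSub Γ Δ) (B : Ty) : PSub (B :: Γ) (B :: Δ)
  | _, Var.z => PTm.var Var.z
  | _, Var.s x => (σ _ x).wk

def PSub.one {Γ : Ctx} {B : Ty} (a : PTm Γ B) : PSub (B :: Γ) Γ
  | _, Var.z => a
  | _, Var.s x => PTm.var x

namespace PTm

def subst : {Γ : Ctx} → {A : Ty} → PTm Γ A → {Δ : Ctx} → PSub Γ Δ → PTm Δ A
  | _, _, .par n A, _, _ => .par n A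
  | _, _, .var x, _, σ => σ _ x
  | _, _, .app t u, _, σ => .app (t.subst σ) (u.subst σ)
  | _, _, .lam t, _, σ => .lam (t.subst (σ.lift _))
  | _, _, .pair t u, _, σ => .pair (t.subst σ) (u.subst σ)
  | _, _, .fst t, _, σ => .fst (t.subst σ)
  | _, _, .snd t, _, σ => .snd (t.subst σ)
  | _, _, .zero, _, _ => .zero
  | _, _, .succ t, _, σ => .succ (t.subst σ)
  | _, _, .eq t u, _, σ => .eq (t.subst σ) (u.subst σ)
  | _, _, .bot, _, _ => .bot
  | _, _, .and p q, _, σ => .and (p.subst σ) (q.subst σ)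
  | _, _, .or p q, _, σ => .or (p.subst σ) (q.subst σ)
  | _, _, .imp p q, _, σ => .imp (p.subst σ) (q.subst σ)
  | _, _, .all A p, _, σ => .all A (p.subst (σ.lift _))
  | _, _, .ex A p, _, σ => .ex A (p.subst (σ.lift _))

def inst {Γ : Ctx} {A B : Ty} (t : PTm (B :: Γ) A) (a : PTm Γ B) : PTm Γ A := t.subst (PSub.one a)

theorem rename_rename {Γ : Ctx} {A : Ty} (t : PTm Γ A) : ∀ {Δ Θ : Ctx} (ρ : Ren Γ Δ) (τ : Ren Δ Θ),
    (t.rename ρ).rename τ = t.rename (fun A x => τ A (ρ A x)) := by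
  induction t <;> intros <;> simp only [rename, Ren.lift_comp, *]

theorem subst_rename {Γ : Ctx} {A : Ty} (t : PTm Γ A) : ∀ {Δ Θ : Ctx} (ρ : Ren Γ Δ) (σ : PSub Δ Θ),
    (t.rename ρ).subst σ = t.subst (fun A x => σ A (ρ A x)) := by
  have key : ∀ {Γ Δ Θ : Ctx} (ρ : Ren Γ Δ) (σ : PSub Δ Θ) (B : Ty),
      (fun A x => σ.lift B A (ρ.lift B A x)) = PSub.lift (fun A x => σ A (ρ A x)) B := by
    intros; funext A x; cases x <;> rfl
  induction t <;> intros <;> simp only [rename, subst, *]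

theorem rename_subst {Γ : Ctx} {A : Ty} (t : PTm Γ A) : ∀ {Δ Θ : Ctx} (σ : PSub Γ Δ) (ρ : Ren Δ Θ),
    (t.subst σ).rename ρ = t.subst (fun A x => (σ A x).rename ρ) := by
  have key : ∀ {Γ Δ Θ : Ctx} (σ : PSub Γ Δ) (ρ : Ren Δ Θ) (B : Ty),
      (fun A x => (σ.lift B A x).rename (ρ.lift B)) = PSub.lift (fun A x => (σ A x).rename ρ) B := by
    intros; funext A x; cases x
    · rfl
    · simp [PSub.lift, wk, rename_rename]; rfl
  induction t <;> intros <;> simp only [rename, subst, *]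

theorem subst_var {Γ : Ctx} {A : Ty} (t : PTm Γ A) : t.subst (fun _ x => PTm.var x) = t := by
  have key : ∀ {Γ : Ctx} (B : Ty), PSub.lift (fun A (x : Var Γ A) => PTm.var x) B = fun _ x => PTm.var x := by
    intros; funext A x; cases x <;> rfl
  induction t <;> simp only [subst, *]

@[simp] theorem wk_subst_lift {Γ Δ : Ctx} {A B : Ty} (t : PTm Γ A) (σ : PSub Γ Δ) :
    (t.wk (B := B)).subst (σ.lift B) = (t.subst σ).wk := by
  simp only [wk, subst_rename, rename_subst]; rfl

@[simp] theorem wk_subst_one {Γ : Ctx} {A B : Ty} (t : PTm Γ A) (a : PTm Γ B) :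
    t.wk.subst (PSub.one a) = t := by
  simp only [wk, subst_rename]; exact subst_var t

end PTm

/-! ### Interpretation of the parameters -/

/-- Interpretation of the parameters by terms in context `Δ`. -/
abbrev Par (Δ : Ctx) : Type := ℕ → (A : Ty) → Tm Δ A

def Par.wk {Δ : Ctx} (θ : Par Δ) (B : Ty) : Par (B :: Δ) := fun n A => (θ n A).wk

namespace PTm

/-- Replace variables and parameters by terms. -/
def tr : {Γ : Ctx} → {A : Ty} → PTm Γ A → {Δ : Ctx} → Sub Γ Δ → Par Δ → Tm Δ A
  | _, _, .par n A, _, _, θ => θ n A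
  | _, _, .var x, _, σ, _ => σ _ x
  | _, _, .app t u, _, σ, θ => .app (t.tr σ θ) (u.tr σ θ)
  | _, _, .lam t, _, σ, θ => .lam (t.tr (σ.lift _) (θ.wk _))
  | _, _, .pair t u, _, σ, θ => .pair (t.tr σ θ) (u.tr σ θ)
  | _, _, .fst t, _, σ, θ => .fst (t.tr σ θ)
  | _, _, .snd t, _, σ, θ => .snd (t.tr σ θ)
  | _, _, .zero, _, _, _ => .zero
  | _, _, .succ t, _, σ, θ => .succ (t.tr σ θ)
  | _, _, .eq t u, _, σ, θ => .eq (t.tr σ θ) (u.tr σ θ)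
  | _, _, .bot, _, _, _ => .bot
  | _, _, .and p q, _, σ, θ => .and (p.tr σ θ) (q.tr σ θ)
  | _, _, .or p q, _, σ, θ => .or (p.tr σ θ) (q.tr σ θ)
  | _, _, .imp p q, _, σ, θ => .imp (p.tr σ θ) (q.tr σ θ)
  | _, _, .all A p, _, σ, θ => .all A (p.tr (σ.lift _) (θ.wk _))
  | _, _, .ex A p, _, σ, θ => .ex A (p.tr (σ.lift _) (θ.wk _))

theorem tr_subst {Γ : Ctx} {A : Ty} (t : PTm Γ A) :
    ∀ {Δ Θ : Ctx} (σ : Sub Γ Δ) (θ : Par Δ) (τ : Sub Δ Θ),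
    (t.tr σ θ).subst τ = t.tr (fun A x => (σ A x).subst τ) (fun n A => (θ n A).subst τ) := by
  have key : ∀ {Γ Δ Θ : Ctx} (σ : Sub Γ Δ) (τ : Sub Δ Θ) (B : Ty),
      (fun A x => (σ.lift B A x).subst (τ.lift B)) = Sub.lift (fun A x => (σ A x).subst τ) B := by
    intros; funext A x; cases x
    · rfl
    · simp [Sub.lift, Tm.wk_subst_lift]
  have key' : ∀ {Δ Θ : Ctx} (θ : Par Δ) (τ : Sub Δ Θ) (B : Ty),
      (fun n A => (θ.wk B n A).subst (τ.lift B)) = Par.wk (fun n A => (θ n A).subst τ) B := by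
    intros; funext n A; simp [Par.wk, Tm.wk_subst_lift]
  induction t <;> intros <;> simp only [tr, Tm.subst, *]

theorem tr_rename {Γ : Ctx} {A : Ty} (t : PTm Γ A) :
    ∀ {Δ Θ : Ctx} (σ : Sub Γ Δ) (θ : Par Δ) (ρ : Ren Δ Θ),
    (t.tr σ θ).rename ρ = t.tr (fun A x => (σ A x).rename ρ) (fun n A => (θ n A).rename ρ) := by
  have key : ∀ {Γ Δ Θ : Ctx} (σ : Sub Γ Δ) (ρ : Ren Δ Θ) (B : Ty),
      (fun A x => (σ.lift B A x).rename (ρ.lift B)) = Sub.lift (fun A x => (σ A x).rename ρ) B := by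
    intros; funext A x; cases x
    · rfl
    · simp [Sub.lift, Tm.wk, Tm.rename_rename]; rfl
  have key' : ∀ {Δ Θ : Ctx} (θ : Par Δ) (ρ : Ren Δ Θ) (B : Ty),
      (fun n A => (θ.wk B n A).rename (ρ.lift B)) = Par.wk (fun n A => (θ n A).rename ρ) B := by
    intros; funext n A; simp [Par.wk, Tm.wk, Tm.rename_rename]; rfl
  induction t <;> intros <;> simp only [tr, Tm.rename, *]

theorem rename_tr {Γ : Ctx} {A : Ty} (t : PTm Γ A) :
    ∀ {Δ Θ : Ctx} (ρ : Ren Γ Δ) (σ : Sub Δ Θ) (θ : Par Θ),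
    (t.rename ρ).tr σ θ = t.tr (fun A x => σ A (ρ A x)) θ := by
  have key : ∀ {Γ Δ Θ : Ctx} (ρ : Ren Γ Δ) (σ : Sub Δ Θ) (B : Ty),
      (fun A x => σ.lift B A (ρ.lift B A x)) = Sub.lift (fun A x => σ A (ρ A x)) B := by
    intros; funext A x; cases x <;> rfl
  induction t <;> intros <;> simp only [tr, rename, *]

theorem subst_tr {Γ : Ctx} {A : Ty} (t : PTm Γ A) :
    ∀ {Δ Θ : Ctx} (τ : PSub Γ Δ) (σ : Sub Δ Θ) (θ : Par Θ),
    (t.subst τ).tr σ θ = t.tr (fun A x => (τ A x).tr σ θ) θ := by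
  have key : ∀ {Γ Δ Θ : Ctx} (τ : PSub Γ Δ) (σ : Sub Δ Θ) (θ : Par Θ) (B : Ty),
      (fun A x => (τ.lift B A x).tr (σ.lift B) (θ.wk B)) = Sub.lift (fun A x => (τ A x).tr σ θ) B := by
    intros; funext A x; cases x
    · rfl
    · simp only [PSub.lift, Sub.lift, wk, Tm.wk, rename_tr, tr_rename]; rfl
  induction t <;> intros <;> simp only [tr, subst, *]

/-- A strict bound for the indices of the parameters in a term. -/
def bound : {Γ : Ctx} → {A : Ty} → PTm Γ A → ℕ
  | _, _, .par n _ => n + 1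
  | _, _, .var _ => 0
  | _, _, .app t u => max t.bound u.bound
  | _, _, .lam t => t.bound
  | _, _, .pair t u => max t.bound u.bound
  | _, _, .fst t => t.bound
  | _, _, .snd t => t.bound
  | _, _, .zero => 0
  | _, _, .succ t => t.bound
  | _, _, .eq t u => max t.bound u.bound
  | _, _, .bot => 0
  | _, _, .and p q => max p.bound q.bound
  | _, _, .or p q => max p.bound q.bound
  | _, _, .imp p q => max p.bound q.bound
  | _, _, .all _ p => p.bound
  | _, _, .ex _ p => p.bound

/-- Only the parameters that occur in a term matter, so a parameter beyond the bound can be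
reinterpreted freely. -/
theorem tr_congr {Γ : Ctx} {A : Ty} (t : PTm Γ A) {N : ℕ} : t.bound ≤ N →
    ∀ {Δ : Ctx} (σ : Sub Γ Δ) (θ θ' : Par Δ), (∀ n < N, θ n = θ' n) → t.tr σ θ = t.tr σ θ' := by
  have key : ∀ {Δ : Ctx} (θ θ' : Par Δ) (B : Ty), (∀ n < N, θ n = θ' n) →
      ∀ n < N, θ.wk B n = θ'.wk B n := by
    intro _ _ _ _ h n hn; funext A; simp only [Par.wk, h n hn]
  induction t with
  | par n A => intro h Δ σ θ θ' hθ; simp only [tr, hθ n h]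
  | var | zero | bot => intros; rfl
  | lam _ ih | all _ _ ih | ex _ _ ih =>
    intro h Δ σ θ θ' hθ; simp only [tr, ih h _ _ _ (key _ _ _ hθ)]
  | fst _ ih | snd _ ih | succ _ ih =>
    intro h Δ σ θ θ' hθ; simp only [tr, ih h _ _ _ hθ]
  | app _ _ ih ih' | pair _ _ ih ih' | eq _ _ ih ih' | and _ _ ih ih' | or _ _ ih ih' | imp _ _ ih ih' =>
    intro h Δ σ θ θ' hθ
    simp only [tr, ih (le_of_max_le_left h) _ _ _ hθ, ih' (le_of_max_le_right h) _ _ _ hθ]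

end PTm

/-! ### Closed terms and fresh parameters -/

def Sub.nil {Δ : Ctx} : Sub [] Δ := fun _ x => nomatch x

namespace PTm

/-- Closed terms. -/
def close {A : Ty} (t : PTm [] A) {Δ : Ctx} (θ : Par Δ) : Tm Δ A := t.tr Sub.nil θ

theorem nil_sub {Δ : Ctx} (σ σ' : Sub [] Δ) : σ = σ' := by
  funext A x; cases x

theorem tr_eq_close {A : Ty} (t : PTm [] A) {Δ : Ctx} (σ : Sub [] Δ) (θ : Par Δ) :
    t.tr σ θ = t.close θ := by
  rw [close, nil_sub σ]

theorem close_wk {A B : Ty} (t : PTm [] A) {Δ : Ctx} (θ : Par Δ) :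
    (t.close θ).wk = t.close (θ.wk B) := by
  simp only [close, Tm.wk, tr_rename]; exact congrArg (fun σ => t.tr σ _) (nil_sub _ _)

/-- The body of a closed binder. -/
def body {A B : Ty} (t : PTm [B] A) {Δ : Ctx} (θ : Par Δ) : Tm (B :: Δ) A :=
  t.tr (Sub.nil.lift B) (θ.wk B)

theorem close_inst {A B : Ty} (t : PTm [B] A) (a : PTm [] B) {Δ : Ctx} (θ : Par Δ) :
    (t.inst a).close θ = (t.body θ).inst (a.close θ) := by
  simp only [inst, close, subst_tr, body, Tm.inst, tr_subst, Par.wk, Tm.wk_subst_one]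
  congr 1
  funext A x; cases x with
  | z => rfl
  | s x => cases x

theorem wk_close {A B : Ty} (t : PTm [] A) {Δ : Ctx} (θ : Par Δ) :
    (t.wk (B := B)).body θ = (t.close θ).wk := by
  rw [close_wk, body, wk, rename_tr, tr_eq_close]

end PTm

/-- Supplies an interpretation of the parameters in the empty context, which is needed to leave the
parametric calculus at the very end. -/
theorem exists_closed : ∀ A : Ty, Nonempty (Tm [] A)
  | .nat => ⟨.zero⟩
  | .omega => ⟨.bot⟩
  | .prod A B => ⟨.pair (exists_closed A).some (exists_closed B).some⟩
  | .arr _ B => ⟨.lam (exists_closed B).some.closed⟩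

open Classical in
/-- Interpret the parameter `c` of type `B` by a new variable. -/
noncomputable def Par.fresh {Δ : Ctx} (θ : Par Δ) (c : ℕ) (B : Ty) : Par (B :: Δ) := fun n A =>
  if h : n = c ∧ B = A then h.2 ▸ Tm.var Var.z else (θ n A).wk

theorem Par.fresh_self {Δ : Ctx} (θ : Par Δ) (c : ℕ) (B : Ty) : θ.fresh c B c B = Tm.var Var.z := by
  simp [Par.fresh]

theorem Par.fresh_of_ne {Δ : Ctx} (θ : Par Δ) {n c : ℕ} (B : Ty) (h : n ≠ c) :
    θ.fresh c B n = θ.wk B n := by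
  funext A; simp [Par.fresh, Par.wk, h]

theorem PTm.close_fresh {A B : Ty} (t : PTm [] A) {Δ : Ctx} (θ : Par Δ) {c : ℕ} (h : t.bound ≤ c) :
    t.close (θ.fresh c B) = (t.close θ).wk := by
  rw [close_wk]
  exact tr_congr _ h _ _ _ fun n hn => Par.fresh_of_ne _ _ (by omega)

/-- The generalization step: an unused parameter put in place of the bound variable, and then read
as a new variable, gives back the body of the binder. -/
theorem PTm.close_inst_fresh {A B : Ty} (t : PTm [B] A) {Δ : Ctx} (θ : Par Δ) {c : ℕ} (h : t.bound ≤ c) :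
    (t.inst (PTm.par c B)).close (θ.fresh c B) = t.body θ := by
  rw [inst, close, subst_tr, body, tr_congr t h _ (θ.fresh c B) (θ.wk B)
    fun n hn => Par.fresh_of_ne _ _ (by omega)]
  congr 1
  funext A x; cases x with
  | z => exact Par.fresh_self _ _ _
  | s x => cases x

/-- Each rule is stable under adding hypotheses; this makes `⊩` monotone in its world. -/
theorem Derives.weaken {T : Set (Fm [])} {Γ : Ctx} {Δ : List (Fm Γ)} {φ : Fm Γ}
    (h : Derives T Δ φ) : ∀ {Δ' : List (Fm Γ)}, Δ ⊆ Δ' → Derives T Δ' φ := by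
  induction h with
  | ax h => intros; exact .ax h
  | hyp h => intro _ hs; exact .hyp (hs h)
  | botE _ ih => intro _ hs; exact .botE (ih hs)
  | andI _ _ ih ih' => intro _ hs; exact .andI (ih hs) (ih' hs)
  | andE₁ _ ih => intro _ hs; exact .andE₁ (ih hs)
  | andE₂ _ ih => intro _ hs; exact .andE₂ (ih hs)
  | orI₁ _ ih => intro _ hs; exact .orI₁ (ih hs)
  | orI₂ _ ih => intro _ hs; exact .orI₂ (ih hs)
  | orE _ _ _ ih ih' ih'' =>
    intro _ hs
    exact .orE (ih hs) (ih' (List.cons_subset_cons _ hs)) (ih'' (List.cons_subset_cons _ hs))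
  | impI _ ih => intro _ hs; exact .impI (ih (List.cons_subset_cons _ hs))
  | impE _ _ ih ih' => intro _ hs; exact .impE (ih hs) (ih' hs)
  | allI _ ih => intro _ hs; exact .allI (ih (List.map_subset _ hs))
  | allE a _ ih => intro _ hs; exact .allE a (ih hs)
  | exI a _ ih => intro _ hs; exact .exI a (ih hs)
  | exE _ _ ih ih' =>
    intro _ hs
    exact .exE (ih hs) (ih' (List.cons_subset_cons _ (List.map_subset _ hs)))
  | eqI a => intros; exact .eqI a
  | eqE φ _ _ ih ih' => intro _ hs; exact .eqE φ (ih hs) (ih' hs)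
  | beta t a => intros; exact .beta t a
  | fnext _ ih => intro _ hs; exact .fnext (ih hs)
  | prext _ ih => intro _ hs; exact .prext (ih hs)
  | fst_pair a b => intros; exact .fst_pair a b
  | snd_pair a b => intros; exact .snd_pair a b
  | pair_eta c => intros; exact .pair_eta c
  | succ_ne_zero n => intros; exact .succ_ne_zero n
  | succ_inj _ ih => intro _ hs; exact .succ_inj (ih hs)
  | induct φ _ _ ih ih' => intro _ hs; exact .induct φ (ih hs) (ih' hs)
  | unique_choice R _ _ ih ih' => intro _ hs; exact .unique_choice R (ih hs) (ih' hs)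

/-! ### Simplification rules for substitution -/

namespace PTm

theorem subst_subst {Γ : Ctx} {A : Ty} (t : PTm Γ A) : ∀ {Δ Θ : Ctx} (σ : PSub Γ Δ) (τ : PSub Δ Θ),
    (t.subst σ).subst τ = t.subst (fun A x => (σ A x).subst τ) := by
  have key : ∀ {Γ Δ Θ : Ctx} (σ : PSub Γ Δ) (τ : PSub Δ Θ) (B : Ty),
      (fun A x => (σ.lift B A x).subst (τ.lift B)) = PSub.lift (fun A x => (σ A x).subst τ) B := by
    intros; funext A x; cases x
    · rfl
    · simp only [PSub.lift, wk_subst_lift]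
  induction t <;> intros <;> simp only [subst, *]

abbrev v0 {Γ : Ctx} {A : Ty} : PTm (A :: Γ) A := var Var.z
abbrev v1 {Γ : Ctx} {A B : Ty} : PTm (B :: A :: Γ) A := var (Var.s Var.z)
abbrev v2 {Γ : Ctx} {A B C : Ty} : PTm (C :: B :: A :: Γ) A := var (Var.s (Var.s Var.z))
abbrev v3 {Γ : Ctx} {A B C D : Ty} : PTm (D :: C :: B :: A :: Γ) A :=
  var (Var.s (Var.s (Var.s Var.z)))
abbrev v4 {Γ : Ctx} {A B C D E : Ty} : PTm (E :: D :: C :: B :: A :: Γ) A :=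
  var (Var.s (Var.s (Var.s (Var.s Var.z))))

def neg {Γ : Ctx} (p : PFm Γ) : PFm Γ := p ⇒ₚ bot

def iff {Γ : Ctx} (p q : PFm Γ) : PFm Γ := (p ⇒ₚ q) ⊓ₚ (q ⇒ₚ p)

section
variable {Γ Δ : Ctx} {A B : Ty} (σ : PSub Γ Δ)

-- Definitional equations, stated as `simp` rules so that instantiating a formula computes to
-- readable form.
@[simp] theorem subst_var_eq (x : Var Γ A) : (var x).subst σ = σ A x := rfl
@[simp] theorem subst_app (t : PTm Γ (A ⟶ₜ B)) (u : PTm Γ A) :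
    (t ⬝ₚ u).subst σ = t.subst σ ⬝ₚ u.subst σ := rfl
@[simp] theorem subst_lam (t : PTm (A :: Γ) B) : (lam t).subst σ = lam (t.subst (σ.lift A)) := rfl
@[simp] theorem subst_pair (t : PTm Γ A) (u : PTm Γ B) :
    (pair t u).subst σ = pair (t.subst σ) (u.subst σ) := rfl
@[simp] theorem subst_fst (t : PTm Γ (Ty.prod A B)) : (fst t).subst σ = fst (t.subst σ) := rfl
@[simp] theorem subst_snd (t : PTm Γ (Ty.prod A B)) : (snd t).subst σ = snd (t.subst σ) := rfl
@[simp] theorem subst_zero : zero.subst σ = zero := rfl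
@[simp] theorem subst_succ (t : PTm Γ Ty.nat) : (succ t).subst σ = succ (t.subst σ) := rfl
@[simp] theorem subst_eq (t u : PTm Γ A) : (t ≐ₚ u).subst σ = (t.subst σ ≐ₚ u.subst σ) := rfl
@[simp] theorem subst_bot : bot.subst σ = bot := rfl
@[simp] theorem subst_and (p q : PFm Γ) : (p ⊓ₚ q).subst σ = (p.subst σ ⊓ₚ q.subst σ) := rfl
@[simp] theorem subst_or (p q : PFm Γ) : (p ⊔ₚ q).subst σ = (p.subst σ ⊔ₚ q.subst σ) := rfl
@[simp] theorem subst_imp (p q : PFm Γ) : (p ⇒ₚ q).subst σ = (p.subst σ ⇒ₚ q.subst σ) := rfl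
@[simp] theorem subst_all (p : PFm (A :: Γ)) : (all A p).subst σ = all A (p.subst (σ.lift A)) := rfl
@[simp] theorem subst_ex (p : PFm (A :: Γ)) : (ex A p).subst σ = ex A (p.subst (σ.lift A)) := rfl
@[simp] theorem subst_neg (p : PFm Γ) : (neg p).subst σ = neg (p.subst σ) := rfl
@[simp] theorem subst_iff (p q : PFm Γ) : (iff p q).subst σ = iff (p.subst σ) (q.subst σ) := rfl
@[simp] theorem lift_z : σ.lift A A Var.z = var Var.z := rfl
@[simp] theorem lift_s (x : Var Γ A) : σ.lift B A (Var.s x) = (σ A x).wk := rfl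
@[simp] theorem one_z (a : PTm Γ A) : PSub.one a A Var.z = a := rfl
@[simp] theorem wk_var (x : Var Γ A) : (var x).wk (B := B) = var (Var.s x) := rfl
@[simp] theorem wk_zero : zero.wk (Γ := Γ) (B := B) = zero := rfl
@[simp] theorem wk_inst (t : PTm Γ A) (a : PTm Γ B) : t.wk.inst a = t := wk_subst_one t a
end

infix:45 " ⇔ₚ " => SynthComp.PTm.iff

/-! ### Entailment between formulas with parameters -/

abbrev World : Type := List (PFm [])

/-- `w ⊩ φ`: every interpretation of the parameters turns `φ` into a formula that is derivable from
the hypotheses `w` in synthetic computability. -/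
structure Pr (w : World) (φ : PFm []) : Prop where
  derives : ∀ {Δ : Ctx} (θ : Par Δ), Derives SynthAx (w.map (fun ψ => ψ.close θ)) (φ.close θ)

infix:25 " ⊩ " => Pr

/-- `w` has all the hypotheses of `v`. -/
class Up (v w : World) : Prop where
  subset : v ⊆ w

instance Up.refl (w : World) : Up w w := ⟨fun _ h => h⟩

/-- `w'` is the world in force after an extension of `w`. -/
class Ext (w : outParam World) (w' : World) : Prop where
  subset : w ⊆ w'

/-- Instance search walks back from `w'` through the successive extensions until it meets `v`. The
first argument of `Ext` is an `outParam`, so each backward step is determined. -/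
instance Up.ext (v w w' : World) [h : Ext w w'] [h' : Up v w] : Up v w' :=
  ⟨fun _ hx => h.subset (h'.subset hx)⟩

theorem Ext.cons (φ : PFm []) (w : World) : Ext w (φ :: w) := ⟨List.subset_cons_self _ _⟩

namespace Pr

variable {v w : World} {A B : Ty}

theorem up {φ : PFm []} (h : v ⊩ φ) [u : Up v w] : w ⊩ φ :=
  .mk fun θ => (h.derives θ).weaken (List.map_subset _ u.subset)

theorem hyp {φ : PFm []} : φ :: w ⊩ φ := .mk fun _ => .hyp (by simp)

theorem botE {φ : PFm []} (h : v ⊩ bot) [Up v w] : w ⊩ φ := .mk fun θ => .botE (h.up.derives θ)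

theorem andI {φ ψ : PFm []} (h : w ⊩ φ) (h' : w ⊩ ψ) : w ⊩ φ ⊓ₚ ψ := .mk fun θ => .andI (h.derives θ) (h'.derives θ)

theorem left {φ ψ : PFm []} (h : w ⊩ φ ⊓ₚ ψ) : w ⊩ φ := .mk fun θ => .andE₁ (h.derives θ)

theorem right {φ ψ : PFm []} (h : w ⊩ φ ⊓ₚ ψ) : w ⊩ ψ := .mk fun θ => .andE₂ (h.derives θ)

theorem inl {φ ψ : PFm []} (h : w ⊩ φ) : w ⊩ φ ⊔ₚ ψ := .mk fun θ => .orI₁ (h.derives θ)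

theorem inr {φ ψ : PFm []} (h : w ⊩ ψ) : w ⊩ φ ⊔ₚ ψ := .mk fun θ => .orI₂ (h.derives θ)

theorem orE {φ ψ χ : PFm []} (h : v ⊩ φ ⊔ₚ ψ) [Up v w]
    (h₁ : ∀ (w' : World) [Ext w w'], w' ⊩ φ → w' ⊩ χ)
    (h₂ : ∀ (w' : World) [Ext w w'], w' ⊩ ψ → w' ⊩ χ) : w ⊩ χ := .mk fun θ =>
  .orE (h.up.derives θ) ((@h₁ (φ :: w) (Ext.cons φ w) hyp).derives θ) ((@h₂ (ψ :: w) (Ext.cons ψ w) hyp).derives θ)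

theorem impI {φ ψ : PFm []}
    (h : ∀ (w' : World) [Ext w w'], w' ⊩ φ → w' ⊩ ψ) : w ⊩ φ ⇒ₚ ψ := .mk fun θ =>
  .impI ((@h (φ :: w) (Ext.cons φ w) hyp).derives θ)

theorem mp {φ ψ : PFm []} (h : v ⊩ φ ⇒ₚ ψ) [Up v w] (h' : w ⊩ φ) : w ⊩ ψ := .mk fun θ =>
  .impE (h.up.derives θ) (h'.derives θ)

theorem negI {φ : PFm []}
    (h : ∀ (w' : World) [Ext w w'], w' ⊩ φ → w' ⊩ bot) : w ⊩ neg φ := impI h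

theorem absurd {φ ψ : PFm []} (h : v ⊩ neg φ) [Up v w] (h' : w ⊩ φ) : w ⊩ ψ := botE (mp h h')

theorem iffI {φ ψ : PFm []}
    (h : ∀ (w' : World) [Ext w w'], w' ⊩ φ → w' ⊩ ψ)
    (h' : ∀ (w' : World) [Ext w w'], w' ⊩ ψ → w' ⊩ φ) : w ⊩ φ ⇔ₚ ψ :=
  andI (impI h) (impI h')

theorem iff_mp {φ ψ : PFm []} (h : v ⊩ φ ⇔ₚ ψ) [Up v w] (h' : w ⊩ φ) : w ⊩ ψ := mp (left h) h'

theorem iff_mpr {φ ψ : PFm []} (h : v ⊩ φ ⇔ₚ ψ) [Up v w] (h' : w ⊩ ψ) : w ⊩ φ := mp (right h) h'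

theorem iff_symm {φ ψ : PFm []} (h : w ⊩ φ ⇔ₚ ψ) : w ⊩ ψ ⇔ₚ φ := andI (right h) (left h)

theorem exists_bound (w : World) : ∃ N, ∀ φ ∈ w, φ.bound ≤ N := by
  induction w with
  | nil => exact ⟨0, by simp⟩
  | cons φ w ih =>
    obtain ⟨N, hN⟩ := ih
    refine ⟨max φ.bound N, fun ψ hψ => ?_⟩
    rcases List.mem_cons.1 hψ with rfl | h
    · exact le_max_left _ _
    · exact (hN _ h).trans (le_max_right _ _)

theorem map_fresh {N c : ℕ} (hN : ∀ φ ∈ w, φ.bound ≤ N) (hc : N ≤ c) {Δ : Ctx} (θ : Par Δ) (A : Ty) :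
    w.map (fun ψ => ψ.close (θ.fresh c A)) = (w.map (fun ψ => ψ.close θ)).map Tm.wk := by
  rw [List.map_map]
  exact List.map_congr_left fun φ hφ => close_fresh φ θ ((hN φ hφ).trans hc)

/-- A single instance of the hypothesis is used, at a parameter that occurs neither in `w` nor in
`φ`. Since `⊩` covers all interpretations, that parameter may be read as the newly bound variable.
-/
theorem allI {φ : PFm [A]} (h : ∀ a : PTm [] A, w ⊩ φ.inst a) : w ⊩ all A φ := by
  refine ⟨fun {Δ} θ => ?_⟩
  obtain ⟨N, hN⟩ := exists_bound w
  refine .allI ?_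
  have := (h (par (max N φ.bound) A)).derives (θ.fresh (max N φ.bound) A)
  rwa [map_fresh hN (le_max_left _ _), close_inst_fresh _ _ (le_max_right _ _)] at this

theorem allE {φ : PFm [A]} (h : w ⊩ all A φ) (a : PTm [] A) : w ⊩ φ.inst a := by
  refine ⟨fun {Δ} θ => ?_⟩
  rw [close_inst]
  exact .allE _ (h.derives θ)

theorem exI {φ : PFm [A]} (a : PTm [] A) (h : w ⊩ φ.inst a) : w ⊩ ex A φ := by
  refine ⟨fun {Δ} θ => ?_⟩
  have := h.derives θ
  rw [close_inst] at this
  exact .exI _ this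

theorem exE {φ : PFm [A]} {χ : PFm []} (h : v ⊩ ex A φ) [Up v w]
    (k : ∀ (w' : World) [Ext w w'] (a : PTm [] A), w' ⊩ φ.inst a → w' ⊩ χ) : w ⊩ χ := by
  refine ⟨fun {Δ} θ => ?_⟩
  obtain ⟨N, hN⟩ := exists_bound w
  refine .exE (h.up.derives θ) ?_
  let c := max N (max φ.bound χ.bound)
  have hφ : φ.bound ≤ c := (le_max_left _ _).trans (le_max_right _ _)
  have hχ : χ.bound ≤ c := (le_max_right _ _).trans (le_max_right _ _)
  have := (@k (φ.inst (par c A) :: w) (Ext.cons _ w) (par c A) hyp).derives (θ.fresh c A)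
  rwa [List.map_cons, map_fresh hN (le_max_left _ _), close_inst_fresh _ _ hφ, close_fresh _ _ hχ]
    at this

theorem rfl {a : PTm [] A} : w ⊩ a ≐ₚ a := .mk fun _ => .eqI _

theorem rewrite (φ : PFm [A]) {a b : PTm [] A} (h : v ⊩ a ≐ₚ b) [Up v w] (h' : w ⊩ φ.inst a) :
    w ⊩ φ.inst b := by
  refine ⟨fun {Δ} θ => ?_⟩
  have := h'.derives θ
  rw [close_inst] at this ⊢
  exact .eqE (φ.body θ) (h.up.derives θ) this

theorem symm {a b : PTm [] A} (h : w ⊩ a ≐ₚ b) : w ⊩ b ≐ₚ a := by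
  have := rewrite (w := w) (v0 ≐ₚ a.wk) h (by simpa [inst] using rfl)
  simpa [inst] using this

theorem trans {a b c : PTm [] A} (h : w ⊩ a ≐ₚ b) (h' : w ⊩ b ≐ₚ c) : w ⊩ a ≐ₚ c := by
  have := rewrite (a.wk ≐ₚ v0) h' (by simpa [inst] using h)
  simpa [inst] using this

theorem congr (t : PTm [A] B) {a b : PTm [] A} (h : w ⊩ a ≐ₚ b) : w ⊩ t.inst a ≐ₚ t.inst b := by
  have := rewrite ((t.inst a).wk ≐ₚ t) h (by
    show w ⊩ (t.inst a).wk.inst a ≐ₚ t.inst a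
    rw [wk_inst]; exact rfl)
  change w ⊩ (t.inst a).wk.inst b ≐ₚ t.inst b at this
  rwa [wk_inst] at this

theorem app_congr {f g : PTm [] (A ⟶ₜ B)} {a b : PTm [] A} (h : w ⊩ f ≐ₚ g) (h' : w ⊩ a ≐ₚ b) :
    w ⊩ f ⬝ₚ a ≐ₚ g ⬝ₚ b := by
  have h₁ := congr (v0 ⬝ₚ a.wk) h
  have h₂ := congr (g.wk ⬝ₚ v0) h'
  simp only [inst, subst_app, subst_var_eq, one_z, wk_subst_one] at h₁ h₂
  exact h₁.trans h₂

theorem arg_congr {f : PTm [] (A ⟶ₜ B)} {a b : PTm [] A} (h' : w ⊩ a ≐ₚ b) :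
    w ⊩ f ⬝ₚ a ≐ₚ f ⬝ₚ b := app_congr rfl h'

theorem fun_congr {f g : PTm [] (A ⟶ₜ B)} {a : PTm [] A} (h : w ⊩ f ≐ₚ g) :
    w ⊩ f ⬝ₚ a ≐ₚ g ⬝ₚ a := app_congr h rfl

theorem succ_congr {a b : PTm [] Ty.nat} (h : w ⊩ a ≐ₚ b) : w ⊩ succ a ≐ₚ succ b := congr (succ v0) h

theorem fst_congr {a b : PTm [] (Ty.prod A B)} (h : w ⊩ a ≐ₚ b) : w ⊩ fst a ≐ₚ fst b :=
  congr (fst v0) h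

theorem snd_congr {a b : PTm [] (Ty.prod A B)} (h : w ⊩ a ≐ₚ b) : w ⊩ snd a ≐ₚ snd b :=
  congr (snd v0) h

theorem cast {p q : PFm []} (h : v ⊩ p ≐ₚ q) [Up v w] (hp : w ⊩ p) : w ⊩ q :=
  rewrite (v0 : PFm [Ty.omega]) h hp

/-- Replace the argument of a predicate by an equal one. -/
theorem mem_congr {S : PTm [] (A ⟶ₜ Ty.omega)} {a b : PTm [] A} (h : v ⊩ a ≐ₚ b) [Up v w]
    (ha : w ⊩ S ⬝ₚ a) : w ⊩ S ⬝ₚ b := cast (arg_congr h) ha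

/-- Replace a predicate by an equal one. -/
theorem mem_of_eq {S T : PTm [] (A ⟶ₜ Ty.omega)} {a : PTm [] A} (h : v ⊩ S ≐ₚ T) [Up v w]
    (ha : w ⊩ S ⬝ₚ a) : w ⊩ T ⬝ₚ a := cast (fun_congr h) ha

theorem beta (t : PTm [A] B) (a : PTm [] A) : w ⊩ lam t ⬝ₚ a ≐ₚ t.inst a := by
  refine ⟨fun {Δ} θ => ?_⟩
  have h : (lam t ⬝ₚ a ≐ₚ t.inst a).close θ
      = (Tm.lam (t.body θ) ⬝ₜ a.close θ ≐ₜ (t.body θ).inst (a.close θ)) := by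
    rw [← close_inst]; exact Eq.refl _
  rw [h]
  exact .beta _ _

theorem mem_lam {t : PFm [A]} {a : PTm [] A} : (w ⊩ lam t ⬝ₚ a) ↔ w ⊩ t.inst a :=
  ⟨cast (v := w) (beta t a), cast (v := w) (symm (beta t a))⟩

theorem fnext {f g : PTm [] (A ⟶ₜ B)} (h : ∀ a, w ⊩ f ⬝ₚ a ≐ₚ g ⬝ₚ a) : w ⊩ f ≐ₚ g := by
  refine ⟨fun {Δ} θ => ?_⟩
  have : w ⊩ all A (f.wk ⬝ₚ v0 ≐ₚ g.wk ⬝ₚ v0) := allI fun a => by simpa [inst] using h a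
  have := this.derives θ
  refine .fnext ?_
  have e : (all A (f.wk ⬝ₚ v0 ≐ₚ g.wk ⬝ₚ v0)).close θ
      = Tm.all A ((f.wk (B := A)).body θ ⬝ₜ SynthComp.v0 ≐ₜ (g.wk (B := A)).body θ ⬝ₜ SynthComp.v0) := Eq.refl _
  rwa [e, wk_close, wk_close] at this

theorem prext {p q : PFm []} (h : w ⊩ p ⇔ₚ q) : w ⊩ p ≐ₚ q := .mk fun θ => .prext (h.derives θ)

/-- Extensionality of predicates. -/
theorem setext {S T : PTm [] (A ⟶ₜ Ty.omega)} (h : ∀ a, w ⊩ S ⬝ₚ a ⇔ₚ T ⬝ₚ a) : w ⊩ S ≐ₚ T :=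
  fnext fun a => prext (h a)

theorem fst_pair (a : PTm [] A) (b : PTm [] B) : w ⊩ fst (pair a b) ≐ₚ a := .mk fun _ => .fst_pair _ _

theorem snd_pair (a : PTm [] A) (b : PTm [] B) : w ⊩ snd (pair a b) ≐ₚ b := .mk fun _ => .snd_pair _ _

theorem succ_ne_zero {n : PTm [] Ty.nat} {φ : PFm []} (h : w ⊩ succ n ≐ₚ zero) : w ⊩ φ :=
  .mk fun θ => .botE (.impE (.succ_ne_zero _) (h.derives θ))

theorem succ_inj {m n : PTm [] Ty.nat} (h : w ⊩ succ m ≐ₚ succ n) : w ⊩ m ≐ₚ n :=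
  .mk fun θ => .succ_inj (h.derives θ)

def _root_.SynthComp.PSub.bump : PSub [Ty.nat] [Ty.nat]
  | _, Var.z => succ v0

theorem induct (φ : PFm [Ty.nat]) (h₀ : w ⊩ φ.inst zero)
    (h₁ : ∀ (w' : World) [Ext w w'] (n : PTm [] Ty.nat),
      w' ⊩ φ.inst n → w' ⊩ φ.inst (succ n)) (n : PTm [] Ty.nat) : w ⊩ φ.inst n := by
  have h₂ : w ⊩ all Ty.nat (φ ⇒ₚ φ.subst PSub.bump) := allI fun n => impI fun w' _ h => by
    have e : (φ.subst PSub.bump).subst (PSub.one n) = φ.inst (succ n) := by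
      rw [subst_subst, inst]
      congr 1
      funext A x; cases x with
      | z => exact Eq.refl _
      | s x => cases x
    rw [e]
    exact h₁ w' n h
  refine allE ⟨fun θ => .induct _ ?_ ?_⟩ n
  · have := h₀.derives θ
    rwa [close_inst] at this
  -- Bumping affects only the bound variable: the interpreted parameters have been weakened past it
  -- and are left unchanged.
  · have e : (φ.body θ).subst Sub.bump = (φ.subst PSub.bump).body θ := by
      rw [body, body, tr_subst, subst_tr]
      congr 1
      · funext A x; cases x with
        | z => exact Eq.refl _
        | s x => cases x
      · funext n A
        simp only [Par.wk, Tm.wk, Tm.subst_rename]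
        exact (Tm.subst_rename (θ n A) (fun _ x => Var.s x) (fun _ x => Tm.var x)).symm.trans
          (Tm.subst_var _)
    have := h₂.derives θ
    change Derives _ _ (Tm.all Ty.nat (φ.body θ ⇒ₜ (φ.subst PSub.bump).body θ)) at this
    rwa [← e] at this

theorem ax {φ : Fm []} {ψ : PFm []} (hφ : SynthAx φ)
    (h : ∀ {Δ : Ctx} (θ : Par Δ), ψ.close θ = φ.closed) : w ⊩ ψ := .mk fun θ => by
  rw [h]; exact .ax hφ

end Pr

/-! ### The notions of synthetic computability for terms with parameters -/

def isBinary {Γ : Ctx} (f : PTm Γ (Ty.nat ⟶ₜ Ty.nat)) : PFm Γ :=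
  all Ty.nat ((f.wk ⬝ₚ v0 ≐ₚ zero) ⊔ₚ (f.wk ⬝ₚ v0 ≐ₚ succ zero))

def hasOne {Γ : Ctx} (f : PTm Γ (Ty.nat ⟶ₜ Ty.nat)) : PFm Γ :=
  ex Ty.nat (f.wk ⬝ₚ v0 ≐ₚ succ zero)

def inSigma {Γ : Ctx} (p : PFm Γ) : PFm Γ :=
  ex (Ty.nat ⟶ₜ Ty.nat) (isBinary v0 ⊓ₚ (p.wk ⇔ₚ hasOne v0))

def inSigmaN {Γ : Ctx} (S : PTm Γ PN) : PFm Γ := all Ty.nat (inSigma (S.wk ⬝ₚ v0))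

def subset {Γ : Ctx} (S S' : PTm Γ PN) : PFm Γ := all Ty.nat (S.wk ⬝ₚ v0 ⇒ₚ S'.wk ⬝ₚ v0)

def intrinsicOpen {Γ : Ctx} (U : PTm Γ PPN) : PFm Γ :=
  all PN (inSigmaN v0 ⇒ₚ inSigma (U.wk ⬝ₚ v0))

def isChain {Γ : Ctx} (c : PTm Γ (Ty.nat ⟶ₜ PN)) : PFm Γ :=
  all Ty.nat (inSigmaN (c.wk ⬝ₚ v0)) ⊓ₚ
    all Ty.nat (subset (c.wk ⬝ₚ v0) (c.wk ⬝ₚ succ v0))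

def isSup {Γ : Ctx} (c : PTm Γ (Ty.nat ⟶ₜ PN)) (S : PTm Γ PN) : PFm Γ :=
  inSigmaN S ⊓ₚ
    all Ty.nat (subset (c.wk ⬝ₚ v0) S.wk) ⊓ₚ
    all PN (inSigmaN v0 ⇒ₚ
      all Ty.nat (subset (c.wk.wk ⬝ₚ v0) v1) ⇒ₚ subset S.wk v0)

def isUpper {Γ : Ctx} (U : PTm Γ PPN) : PFm Γ :=
  all PN (all PN (inSigmaN v1 ⇒ₚ inSigmaN v0 ⇒ₚ
      U.wk.wk ⬝ₚ v1 ⇒ₚ subset v1 v0 ⇒ₚ U.wk.wk ⬝ₚ v0))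

def inaccessible {Γ : Ctx} (U : PTm Γ PPN) : PFm Γ :=
  all (Ty.nat ⟶ₜ PN) (all PN (isChain v1 ⇒ₚ isSup v1 v0 ⇒ₚ
      U.wk.wk ⬝ₚ v0 ⇒ₚ ex Ty.nat (U.wk.wk.wk ⬝ₚ (v2 ⬝ₚ v0))))

def scottOpen {Γ : Ctx} (U : PTm Γ PPN) : PFm Γ := intrinsicOpen U ⊓ₚ isUpper U ⊓ₚ inaccessible U

def emptySet {Γ : Ctx} : PTm Γ PN := lam bot

def insert {Γ : Ctx} (S : PTm Γ PN) (n : PTm Γ Ty.nat) : PTm Γ PN :=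
  lam ((S.wk ⬝ₚ v0) ⊔ₚ (v0 ≐ₚ n.wk))

def isFinite {Γ : Ctx} (S : PTm Γ PN) : PFm Γ :=
  all PPN (v0 ⬝ₚ emptySet ⇒ₚ
    all PN (all Ty.nat (v2 ⬝ₚ v1 ⇒ₚ v2 ⬝ₚ insert v1 v0)) ⇒ₚ v0 ⬝ₚ S.wk)

def countableUnionOfBasic {Γ : Ctx} (U : PTm Γ PPN) : PFm Γ :=
  ex PN (ex (Ty.nat ⟶ₜ PN)
    (inSigmaN v1 ⊓ₚ
      all Ty.nat (v2 ⬝ₚ v0 ⇒ₚ isFinite (v1 ⬝ₚ v0)) ⊓ₚ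
      all PN (inSigmaN v0 ⇒ₚ
        (U.wk.wk.wk ⬝ₚ v0 ⇔ₚ ex Ty.nat (v3 ⬝ₚ v0 ⊓ₚ subset (v2 ⬝ₚ v0) v1)))))

def unionOfItsBasic {Γ : Ctx} (U : PTm Γ PPN) : PFm Γ :=
  all PN (inSigmaN v0 ⇒ₚ
    (U.wk ⬝ₚ v0 ⇔ₚ ex PN (isFinite v0 ⊓ₚ subset v0 v1 ⊓ₚ U.wk.wk ⬝ₚ v0)))

def intrinsicIsScott : PFm [] :=
  all PPN
    ((intrinsicOpen v0 ⇔ₚ scottOpen v0) ⊓ₚ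
      (intrinsicOpen v0 ⇔ₚ countableUnionOfBasic v0) ⊓ₚ
      (intrinsicOpen v0 ⇒ₚ unionOfItsBasic v0))

/-- A sentence without parameters does not see their interpretation, so arbitrary closed terms may
be chosen. -/
theorem holds_of_pr {φ : PFm []} {ψ : Fm []} (h : [] ⊩ φ) (e : ∀ θ : Par [], φ.close θ = ψ) :
    Holds ψ := by
  rw [← e fun _ A => (exists_closed A).some]
  exact h.derives _

/-- Definitional, since each parametric notion copies its original clause by clause. -/
theorem intrinsicIsScott_close_nil (θ : Par []) :
    intrinsicIsScott.close θ = SynthComp.intrinsicIsScott := rfl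

section
variable {Γ Δ : Ctx} (σ : PSub Γ Δ)

-- These rules let substitution pass through the defined notions without unfolding them.
@[simp] theorem subst_isBinary (f : PTm Γ (Ty.nat ⟶ₜ Ty.nat)) :
    (isBinary f).subst σ = isBinary (f.subst σ) := by simp [isBinary]
@[simp] theorem subst_hasOne (f : PTm Γ (Ty.nat ⟶ₜ Ty.nat)) :
    (hasOne f).subst σ = hasOne (f.subst σ) := by simp [hasOne]
@[simp] theorem subst_inSigma (p : PFm Γ) : (inSigma p).subst σ = inSigma (p.subst σ) := by
  simp [inSigma]
@[simp] theorem subst_inSigmaN (S : PTm Γ PN) : (inSigmaN S).subst σ = inSigmaN (S.subst σ) := by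
  simp [inSigmaN]
@[simp] theorem subst_subset (S T : PTm Γ PN) :
    (subset S T).subst σ = subset (S.subst σ) (T.subst σ) := by simp [subset]
@[simp] theorem subst_intrinsicOpen (U : PTm Γ PPN) :
    (intrinsicOpen U).subst σ = intrinsicOpen (U.subst σ) := by simp [intrinsicOpen]
@[simp] theorem subst_isChain (c : PTm Γ (Ty.nat ⟶ₜ PN)) :
    (isChain c).subst σ = isChain (c.subst σ) := by simp [isChain]
@[simp] theorem subst_isSup (c : PTm Γ (Ty.nat ⟶ₜ PN)) (S : PTm Γ PN) :
    (isSup c S).subst σ = isSup (c.subst σ) (S.subst σ) := by simp [isSup]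
@[simp] theorem subst_isUpper (U : PTm Γ PPN) : (isUpper U).subst σ = isUpper (U.subst σ) := by
  simp [isUpper]
@[simp] theorem subst_inaccessible (U : PTm Γ PPN) :
    (inaccessible U).subst σ = inaccessible (U.subst σ) := by simp [inaccessible]
@[simp] theorem subst_scottOpen (U : PTm Γ PPN) : (scottOpen U).subst σ = scottOpen (U.subst σ) := by
  simp [scottOpen]
@[simp] theorem subst_emptySet : emptySet.subst σ = emptySet := rfl
@[simp] theorem subst_insert (S : PTm Γ PN) (n : PTm Γ Ty.nat) :
    (insert S n).subst σ = insert (S.subst σ) (n.subst σ) := by simp [insert]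
@[simp] theorem subst_isFinite (S : PTm Γ PN) : (isFinite S).subst σ = isFinite (S.subst σ) := by
  simp [isFinite]
@[simp] theorem subst_countableUnionOfBasic (U : PTm Γ PPN) :
    (countableUnionOfBasic U).subst σ = countableUnionOfBasic (U.subst σ) := by
  simp [countableUnionOfBasic]
@[simp] theorem subst_unionOfItsBasic (U : PTm Γ PPN) :
    (unionOfItsBasic U).subst σ = unionOfItsBasic (U.subst σ) := by simp [unionOfItsBasic]

end

variable {v w : World} {A B : Ty}

/-! ### The axioms as rules -/

/-- In continuation form, so that the chosen sequence is available as a closed term in an extended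
world. -/
theorem dependentChoice (X : PTm [] (A ⟶ₜ Ty.omega)) (R : PTm [] (A ⟶ₜ A ⟶ₜ Ty.omega))
    (hR : ∀ (w' : World) [Ext w w'] (x : PTm [] A), w' ⊩ X ⬝ₚ x →
      w' ⊩ ex A (X.wk ⬝ₚ v0 ⊓ₚ R.wk ⬝ₚ x.wk ⬝ₚ v0))
    {a : PTm [] A} (ha : w ⊩ X ⬝ₚ a) {χ : PFm []}
    (k : ∀ (w' : World) [Ext w w'] (f : PTm [] (Ty.nat ⟶ₜ A)), w' ⊩ f ⬝ₚ zero ≐ₚ a →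
      (∀ n, w' ⊩ X ⬝ₚ (f ⬝ₚ n)) → (∀ n, w' ⊩ R ⬝ₚ (f ⬝ₚ n) ⬝ₚ (f ⬝ₚ succ n)) → w' ⊩ χ) :
    w ⊩ χ := by
  have h : w ⊩ all (A ⟶ₜ Ty.omega) (all (A ⟶ₜ A ⟶ₜ Ty.omega) (
    all A (v2 ⬝ₚ v0 ⇒ₚ ex A (v3 ⬝ₚ v0 ⊓ₚ v2 ⬝ₚ v1 ⬝ₚ v0)) ⇒ₚ
    all A (v2 ⬝ₚ v0 ⇒ₚ
      ex (Ty.nat ⟶ₜ A) ((v0 ⬝ₚ zero ≐ₚ v1) ⊓ₚ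
        all Ty.nat (v4 ⬝ₚ (v1 ⬝ₚ v0) ⊓ₚ v3 ⬝ₚ (v1 ⬝ₚ v0) ⬝ₚ (v1 ⬝ₚ succ v0)))))) :=
    .ax (.dependentChoice A) fun _ => rfl
  have h := (h.allE X).allE R
  simp [inst] at h
  have h := (h.mp (.allI fun x => .impI fun w' _ hx => by
    simp at hx ⊢; exact hR w' x hx)).allE a
  simp [inst] at h
  refine (h.mp ha).exE fun w' _ f hf => ?_
  simp [inst] at hf
  refine k w' f hf.left (fun n => ?_) fun n => ?_
  · simpa [inst] using (hf.right.allE n).left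
  · simpa [inst] using (hf.right.allE n).right

theorem markov {f : PTm [] (Ty.nat ⟶ₜ Ty.nat)} (hf : w ⊩ isBinary f)
    (h : w ⊩ neg (all Ty.nat (f.wk ⬝ₚ v0 ≐ₚ zero))) : w ⊩ hasOne f := by
  have hm : w ⊩ all (Ty.nat ⟶ₜ Ty.nat)
    (isBinary v0 ⇒ₚ neg (all Ty.nat (v1 ⬝ₚ v0 ≐ₚ zero)) ⇒ₚ hasOne v0) := .ax .markov fun _ => rfl
  have hm := hm.allE f
  simp [inst] at hm
  exact (hm.mp hf).mp h

theorem enumerability {χ : PFm []}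
    (k : ∀ (w' : World) [Ext w w'] (W : PTm [] (Ty.nat ⟶ₜ PN)), (∀ n, w' ⊩ inSigmaN (W ⬝ₚ n)) →
      (∀ S, w' ⊩ inSigmaN S ⇒ₚ ex Ty.nat (W.wk ⬝ₚ v0 ≐ₚ S.wk)) → w' ⊩ χ) : w ⊩ χ := by
  have h : w ⊩ ex (Ty.nat ⟶ₜ PN)
    (all Ty.nat (inSigmaN (v1 ⬝ₚ v0)) ⊓ₚ
      all PN (inSigmaN v0 ⇒ₚ ex Ty.nat (v2 ⬝ₚ v0 ≐ₚ v1))) := .ax .enumerability fun _ => rfl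
  refine h.exE fun w' _ W hW => ?_
  simp [inst] at hW
  refine k w' W (fun n => ?_) fun S => ?_
  · simpa [inst] using hW.left.allE n
  · simpa [inst] using hW.right.allE S

/-! ### Arithmetic -/

theorem nat_cases (n : PTm [] Ty.nat) : w ⊩ (n ≐ₚ zero) ⊔ₚ ex Ty.nat (n.wk ≐ₚ succ v0) := by
  have := Pr.induct (w := w) ((v0 ≐ₚ zero) ⊔ₚ ex Ty.nat (v1 ≐ₚ succ v0)) (.inl .rfl)
    (fun w' _ n _ => .inr (.exI n (by simpa [inst] using Pr.rfl))) n
  simpa [inst] using this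

/-- Equality of natural numbers is decidable. -/
theorem nat_dec (n m : PTm [] Ty.nat) : w ⊩ (n ≐ₚ m) ⊔ₚ neg (n ≐ₚ m) := by
  -- The second number stays quantified, since the inductive step compares predecessors.
  have := Pr.induct (w := w) (all Ty.nat ((v1 ≐ₚ v0) ⊔ₚ neg (v1 ≐ₚ v0)))
    (.allI fun m => by
      simp only [inst, subst_or, subst_neg, subst_eq, subst_var_eq, lift_s, lift_z, one_z, wk_zero]
      refine (nat_cases (w := w) m).orE (fun w' _ h => .inl (by simpa using h.symm))
        fun w' _ h => .inr (.negI fun w' _ h' => h.exE fun w' _ k hk => ?_)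
      simp [inst] at hk h'
      exact .succ_ne_zero (hk.symm.trans h'.up.symm))
    (fun w' _ n ih => .allI fun m => by
      simp [inst] at ih ⊢
      refine (nat_cases (w := w') m).orE (fun w' _ h => .inr (.negI fun w' _ h' =>
        .succ_ne_zero (h'.trans h.up))) fun w' _ h => h.exE fun w' _ k hk => ?_
      simp [inst] at hk
      have ih := ih.allE k
      simp [inst] at ih
      exact ih.orE (fun w' _ h => .inl ((Pr.succ_congr h).trans hk.symm.up))
        fun w' _ h => .inr (.negI fun w' _ h' => h.mp (.succ_inj (h'.trans hk.up)))) n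
  have := this.allE m
  simpa [inst] using this

/-- `i < k` -/
def lt {Γ : Ctx} (i k : PTm Γ Ty.nat) : PFm Γ :=
  all PN (v0 ⬝ₚ succ i.wk ⇒ₚ all Ty.nat (v1 ⬝ₚ v0 ⇒ₚ v1 ⬝ₚ succ v0) ⇒ₚ v0 ⬝ₚ k.wk)

@[simp] theorem subst_lt {Γ Δ : Ctx} (σ : PSub Γ Δ) (i k : PTm Γ Ty.nat) :
    (lt i k).subst σ = lt (i.subst σ) (k.subst σ) := by simp [lt]

/-- The order is the impredicative closure of `i + 1` under successor; instantiating the closure at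
`{x | φ x}` gives induction starting at `i + 1`. -/
theorem lt_elim (φ : PFm [Ty.nat]) {i k : PTm [] Ty.nat} (h : w ⊩ lt i k) (h₀ : w ⊩ φ.inst (succ i))
    (h₁ : ∀ (w' : World) [Ext w w'] (n : PTm [] Ty.nat), w' ⊩ φ.inst n → w' ⊩ φ.inst (succ n)) :
    w ⊩ φ.inst k := by
  have := h.allE (lam φ)
  simp only [inst, subst_imp, subst_all, subst_app, subst_var_eq, one_z, subst_succ,
    wk_subst_one, lift_z, lift_s] at this
  refine Pr.mem_lam.1 ((this.mp (Pr.mem_lam.2 h₀)).mp (.allI fun n => ?_))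
  simp only [inst, subst_imp, subst_app, subst_var_eq, one_z, subst_succ, wk_subst_one]
  exact .impI fun w' _ hn => Pr.mem_lam.2 (h₁ w' n (Pr.mem_lam.1 hn))

theorem ltI {i k : PTm [] Ty.nat} (h : ∀ (w' : World) [Ext w w'] (S : PTm [] PN),
    w' ⊩ S ⬝ₚ succ i → (∀ n, w' ⊩ S ⬝ₚ n ⇒ₚ S ⬝ₚ succ n) → w' ⊩ S ⬝ₚ k) : w ⊩ lt i k := by
  refine .allI fun S => ?_
  simp [inst]
  refine .impI fun w₁ _ h₀ => .impI fun w₂ _ h₁ => ?_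
  -- Two nested extensions are composed by hand, as instance search does not compose `Ext`.
  have := @h w₂ ⟨fun _ h => Ext.subset (Ext.subset h)⟩ S h₀.up fun n => by simpa [inst] using h₁.allE n
  exact this

theorem lt_succ_self (i : PTm [] Ty.nat) : w ⊩ lt i (succ i) := ltI fun _ _ _ h _ => h

theorem lt_succ {i k : PTm [] Ty.nat} (h : w ⊩ lt i k) : w ⊩ lt i (succ k) := by
  have := lt_elim (lt i.wk (succ v0)) h (by
    simp [inst]; exact ltI fun w' _ S h₀ h₁ => (h₁ _).mp h₀) fun w' _ n hn => by
    simp [inst] at hn ⊢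
    refine ltI fun w₁ _ S h₀ h₁ => (h₁ _).mp ?_
    have := hn.up (w := w₁).allE S
    simp [inst] at this
    exact (this.mp h₀).mp (.allI fun n => by simpa [inst] using h₁ n)
  simpa [inst] using this

theorem lt_succ_cases {i k : PTm [] Ty.nat} (h : w ⊩ lt i (succ k)) : w ⊩ lt i k ⊔ₚ (i ≐ₚ k) := by
  -- The induction runs over the upper end, so the predicate has to name its predecessor;
  -- injectivity of successor later identifies that predecessor with `k`.
  have := lt_elim (ex Ty.nat ((v1 ≐ₚ succ v0) ⊓ₚ (lt i.wk.wk v0 ⊔ₚ (i.wk.wk ≐ₚ v0)))) h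
    (.exI i (by simpa [inst] using .andI .rfl (.inr .rfl))) fun w' _ n hn => by
    simp [inst] at hn ⊢
    refine .exI n ?_
    simp [inst]
    refine .andI .rfl (hn.exE fun w₁ _ m hm => ?_)
    simp [inst] at hm
    have e := hm.left
    refine hm.right.orE (fun w₂ _ h => .inl ?_) fun w₂ _ h => .inl ?_
    · have := Pr.rewrite (lt i.wk v0) e.symm (w := w₂) (by simpa [inst] using lt_succ h)
      simpa [inst] using this
    · have := Pr.rewrite (lt i.wk v0) (w := w₂) ((Pr.succ_congr h).trans e.symm.up)
        (by simpa [inst] using lt_succ_self i)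
      simpa [inst] using this
  simp [inst] at this
  refine this.exE fun w₁ _ m hm => ?_
  simp [inst] at hm
  have e := hm.left.succ_inj
  have := Pr.rewrite (lt i.wk v0 ⊔ₚ (i.wk ≐ₚ v0)) e.symm (by simpa [inst] using hm.right)
  simpa [inst] using this

theorem lt_zero {i : PTm [] Ty.nat} {χ : PFm []} (h : w ⊩ lt i zero) : w ⊩ χ := by
  have := lt_elim (ex Ty.nat (v1 ≐ₚ succ v0)) h (.exI i (by simpa [inst] using .rfl))
    fun w' _ n _ => .exI n (by simpa [inst] using .rfl)
  simp [inst] at this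
  refine this.exE fun w₁ _ m hm => ?_
  simp [inst] at hm
  exact .succ_ne_zero hm.symm

theorem succ_lt_succ {i k : PTm [] Ty.nat} (h : w ⊩ lt i k) : w ⊩ lt (succ i) (succ k) := by
  have := lt_elim (lt (succ i.wk) (succ v0)) h (by simpa [inst] using lt_succ_self _)
    fun w' _ n hn => by simp [inst] at hn ⊢; exact lt_succ hn
  simpa [inst] using this

theorem lt_congr {i i' k k' : PTm [] Ty.nat} (h : w ⊩ i ≐ₚ i') (h' : w ⊩ k ≐ₚ k')
    (h'' : w ⊩ lt i k) : w ⊩ lt i' k' := by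
  have := Pr.rewrite (lt v0 k.wk) h (by simpa [inst] using h'')
  have := Pr.rewrite (lt i'.wk v0) h' (by simpa [inst] using this)
  simpa [inst] using this

theorem lt_total (i m : PTm [] Ty.nat) : w ⊩ lt i m ⊔ₚ lt m (succ i) := by
  have := Pr.induct (w := w) (lt i.wk v0 ⊔ₚ lt v0 (succ i.wk))
    (.inr (by
      have := Pr.induct (w := w) (lt zero (succ v0)) (by simpa [inst] using lt_succ_self _)
        (fun w' _ n hn => by simpa [inst] using lt_succ hn) i
      simpa [inst] using this))
    (fun w' _ n hn => by
      simp [inst] at hn ⊢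
      refine hn.orE (fun w₁ _ h => .inl (lt_succ h)) fun w₁ _ h => ?_
      refine (lt_succ_cases h).orE (fun w₂ _ h => .inr (succ_lt_succ h)) fun w₂ _ h => .inl ?_
      exact lt_congr .rfl (.succ_congr h.symm) (lt_succ_self i)) m
  simpa [inst] using this

/-! ### Countable choice and pairing -/

theorem mem_lam₂ {t : PFm [B, A]} {a : PTm [] A} {b : PTm [] B} :
    (w ⊩ lam (lam t) ⬝ₚ a ⬝ₚ b) ↔ w ⊩ (t.subst ((PSub.one a).lift B)).inst b :=
  ⟨fun h => Pr.mem_lam.1 (Pr.mem_of_eq (v := w) (Pr.beta _ _) h),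
    fun h => Pr.mem_of_eq (v := w) (Pr.symm (Pr.beta _ _)) (Pr.mem_lam.2 h)⟩

theorem rel_congr {R : PTm [] (A ⟶ₜ B ⟶ₜ Ty.omega)} {a a' : PTm [] A} {b b' : PTm [] B}
    (h : w ⊩ a ≐ₚ a') (h' : w ⊩ b ≐ₚ b') (hR : w ⊩ R ⬝ₚ a ⬝ₚ b) : w ⊩ R ⬝ₚ a' ⬝ₚ b' :=
  (Pr.app_congr (.arg_congr h) h').cast hR

/-- Dependent choice on the pairs `(n, b)` with `R n b`, where each step raises `n` by one. A run
that starts at index `0` has index `n` at time `n`, and its second components form the choice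
function. -/
theorem countableChoice (R : PTm [] (Ty.nat ⟶ₜ B ⟶ₜ Ty.omega))
    (h : ∀ n : PTm [] Ty.nat, w ⊩ ex B (R.wk ⬝ₚ n.wk ⬝ₚ v0)) {χ : PFm []}
    (k : ∀ (w' : World) [Ext w w'] (f : PTm [] (Ty.nat ⟶ₜ B)),
      (∀ n, w' ⊩ R ⬝ₚ n ⬝ₚ (f ⬝ₚ n)) → w' ⊩ χ) : w ⊩ χ := by
  refine (h zero).exE fun w₁ e₁ b₀ hb₀ => ?_
  simp [inst] at hb₀
  refine dependentChoice (w := w₁) (A := Ty.prod Ty.nat B) (lam (R.wk ⬝ₚ fst v0 ⬝ₚ snd v0))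
    (lam (lam (fst v0 ≐ₚ succ (fst v1)))) (fun w₂ _ x hx => ?_) (a := pair zero b₀) ?_
    fun w₂ e₂ f hf₀ hfX hf => ?_
  · refine (h (succ (fst x))).exE fun w₃ _ b hb => .exI (pair (succ (fst x)) b) ?_
    simp [inst] at hb ⊢
    refine .andI (Pr.mem_lam.2 ?_) (mem_lam₂.2 ?_)
    · simpa [inst] using rel_congr (Pr.fst_pair _ _).symm (Pr.snd_pair _ _).symm hb
    · simpa [inst] using Pr.fst_pair _ _
  · refine Pr.mem_lam.2 ?_
    simpa [inst] using rel_congr (Pr.fst_pair _ _).symm (Pr.snd_pair _ _).symm hb₀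
  · have hn (n : PTm [] Ty.nat) : w₂ ⊩ fst (f ⬝ₚ n) ≐ₚ n := by
      have := Pr.induct (w := w₂) (fst (f.wk ⬝ₚ v0) ≐ₚ v0)
        (by simpa [inst] using (Pr.fst_congr hf₀).trans (Pr.fst_pair _ _)) (fun w₃ _ n ih => by
          simp [inst] at ih ⊢
          have := mem_lam₂.1 ((hf n).up (w := w₃))
          simp [inst] at this
          exact this.trans (.succ_congr ih)) n
      simpa [inst] using this
    refine @k w₂ ⟨fun _ h => Ext.subset (Ext.subset h)⟩ (lam (snd (f.wk ⬝ₚ v0))) fun n => ?_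
    have := Pr.mem_lam.1 (hfX n)
    simp [inst] at this
    refine rel_congr (hn n) (.symm ?_) this
    simpa [inst] using Pr.beta (w := w₂) (snd (f.wk ⬝ₚ v0)) n

/-- `(a, b, s)` is a value of `f`. -/
def attains {Γ : Ctx} (f : PTm Γ (Ty.nat ⟶ₜ Ty.prod Ty.nat (Ty.prod Ty.nat Ty.nat)))
    (a b s : PTm Γ Ty.nat) : PFm Γ :=
  ex Ty.nat (f.wk ⬝ₚ v0 ≐ₚ pair a.wk (pair b.wk s.wk))

@[simp] theorem subst_attains {Γ Δ : Ctx} (σ : PSub Γ Δ)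
    (f : PTm Γ (Ty.nat ⟶ₜ Ty.prod Ty.nat (Ty.prod Ty.nat Ty.nat))) (a b s : PTm Γ Ty.nat) :
    (attains f a b s).subst σ = attains (f.subst σ) (a.subst σ) (b.subst σ) (s.subst σ) := by
  simp [attains]

/-- A walk through `ℕ × ℕ × ℕ` along the diagonals of the first two components; the third component
remembers where the diagonal started. -/
def diagonalStep : PTm [] (Ty.prod Ty.nat (Ty.prod Ty.nat Ty.nat) ⟶ₜ
    Ty.prod Ty.nat (Ty.prod Ty.nat Ty.nat) ⟶ₜ Ty.omega) :=
  lam (lam (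
    ((fst v1 ≐ₚ zero) ⊓ₚ (v0 ≐ₚ pair (succ (snd (snd v1))) (pair zero (succ (snd (snd v1)))))) ⊔ₚ
    ex Ty.nat ((fst v2 ≐ₚ succ v0) ⊓ₚ
      (v1 ≐ₚ pair v0 (pair (succ (fst (snd v2))) (snd (snd v2)))))))

theorem pair_congr {a a' : PTm [] A} {b b' : PTm [] B} (h : w ⊩ a ≐ₚ a') (h' : w ⊩ b ≐ₚ b') :
    w ⊩ pair a b ≐ₚ pair a' b' := by
  have h₁ := Pr.congr (pair v0 b.wk) h
  have h₂ := Pr.congr (pair a'.wk v0) h'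
  simp [inst] at h₁ h₂
  exact h₁.trans h₂

theorem diagonalStep_total (x : PTm [] (Ty.prod Ty.nat (Ty.prod Ty.nat Ty.nat))) :
    w ⊩ ex _ (diagonalStep.wk ⬝ₚ x.wk ⬝ₚ v0) := by
  refine (nat_cases (w := w) (fst x)).orE (fun w₁ _ h => ?_) fun w₁ _ h => h.exE fun w₂ _ a ha => ?_
  · refine .exI (pair (succ (snd (snd x))) (pair zero (succ (snd (snd x))))) ?_
    simp [inst]
    refine mem_lam₂.2 ?_
    simp [inst]
    exact .inl (.andI h .rfl)
  · refine .exI (pair a (pair (succ (fst (snd x))) (snd (snd x)))) ?_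
    simp [inst] at ha ⊢
    refine mem_lam₂.2 ?_
    simp [inst]
    exact .inr (.exI a (by simpa [inst] using .andI ha .rfl))

theorem diagonalStep_zero {b s : PTm [] Ty.nat} {x y : PTm [] (Ty.prod Ty.nat (Ty.prod Ty.nat Ty.nat))}
    (hx : w ⊩ x ≐ₚ pair zero (pair b s)) (h : w ⊩ diagonalStep ⬝ₚ x ⬝ₚ y) :
    w ⊩ y ≐ₚ pair (succ s) (pair zero (succ s)) := by
  have h := mem_lam₂.1 h
  simp [inst] at h
  have h₁ : w ⊩ fst x ≐ₚ zero := (Pr.fst_congr hx).trans (Pr.fst_pair _ _)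
  have h₂ : w ⊩ snd (snd x) ≐ₚ s := (Pr.snd_congr ((Pr.snd_congr hx).trans (Pr.snd_pair _ _))).trans
    (Pr.snd_pair _ _)
  refine h.orE (fun w₁ _ h => h.right.trans ?_) fun w₁ _ h => h.exE fun w₂ _ a ha => ?_
  · exact pair_congr (.succ_congr h₂.up) (pair_congr .rfl (.succ_congr h₂.up))
  · simp [inst] at ha
    exact .succ_ne_zero (ha.left.symm.trans h₁.up)

theorem diagonalStep_succ {a b s : PTm [] Ty.nat} {x y : PTm [] (Ty.prod Ty.nat (Ty.prod Ty.nat Ty.nat))}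
    (hx : w ⊩ x ≐ₚ pair (succ a) (pair b s)) (h : w ⊩ diagonalStep ⬝ₚ x ⬝ₚ y) :
    w ⊩ y ≐ₚ pair a (pair (succ b) s) := by
  have h := mem_lam₂.1 h
  simp [inst] at h
  have h₁ : w ⊩ fst x ≐ₚ succ a := (Pr.fst_congr hx).trans (Pr.fst_pair _ _)
  have h₂ : w ⊩ snd (snd x) ≐ₚ s := (Pr.snd_congr ((Pr.snd_congr hx).trans (Pr.snd_pair _ _))).trans
    (Pr.snd_pair _ _)
  have h₃ : w ⊩ fst (snd x) ≐ₚ b := (Pr.fst_congr ((Pr.snd_congr hx).trans (Pr.snd_pair _ _))).trans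
    (Pr.fst_pair _ _)
  refine h.orE (fun w₁ _ h => .succ_ne_zero (h₁.up.symm.trans h.left)) fun w₁ _ h =>
    h.exE fun w₂ _ a' ha => ?_
  simp [inst] at ha
  exact ha.right.trans (pair_congr (Pr.succ_inj (ha.left.symm.trans h₁.up))
    (pair_congr (.succ_congr h₃.up) h₂.up))

/-- There is a surjection `ℕ → ℕ × ℕ`. -/
theorem pairing {χ : PFm []}
    (k : ∀ (w' : World) [Ext w w'] (r s : PTm [] (Ty.nat ⟶ₜ Ty.nat)),
      (∀ a b : PTm [] Ty.nat, w' ⊩ ex Ty.nat ((r.wk ⬝ₚ v0 ≐ₚ a.wk) ⊓ₚ (s.wk ⬝ₚ v0 ≐ₚ b.wk))) → w' ⊩ χ) : w ⊩ χ := by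
  refine dependentChoice (w := w) (lam (zero ≐ₚ zero)) diagonalStep (fun w₁ _ x _ => ?_)
    (a := pair zero (pair zero zero)) (Pr.mem_lam.2 .rfl) fun w₁ _ f hf₀ _ hf => ?_
  · refine (diagonalStep_total (w := w₁) x).exE fun w₂ _ y hy => .exI y ?_
    simp [inst] at hy ⊢
    exact .andI (Pr.mem_lam.2 .rfl) hy
  -- At the end of a diagonal the walk jumps to the start of the next one; recording the start makes
  -- addition unnecessary.
  have h₁ : ∀ (w₂ : World) [Up w₁ w₂] (b s), w₂ ⊩ attains f zero b s →
      w₂ ⊩ attains f (succ s) zero (succ s) := fun w₂ _ b s h => h.exE fun w₃ _ n hn => by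
    simp [inst] at hn
    exact .exI (succ n) (by simpa [inst] using diagonalStep_zero hn (hf n).up)
  have h₂ : ∀ (w₂ : World) [Up w₁ w₂] (a b s), w₂ ⊩ attains f (succ a) b s →
      w₂ ⊩ attains f a (succ b) s := fun w₂ _ a b s h => h.exE fun w₃ _ n hn => by
    simp [inst] at hn
    exact .exI (succ n) (by simpa [inst] using diagonalStep_succ hn (hf n).up)
  -- Induction on `a`: the walk follows a diagonal down to first component zero.
  have h₃ : ∀ (w₂ : World) [Up w₁ w₂] (a b s), w₂ ⊩ attains f a b s →
      w₂ ⊩ ex Ty.nat (attains f.wk zero v0 s.wk) := fun w₂ _ a b s h => by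
    have := Pr.induct (w := w₂) (all Ty.nat (attains f.wk.wk v1 v0 s.wk.wk ⇒ₚ
      ex Ty.nat (attains f.wk.wk.wk zero v0 s.wk.wk.wk))) (.allI fun b => by
        simp [inst]
        exact .impI fun w₃ _ h => .exI b (by simpa [inst] using h)) (fun w₃ _ a ih => .allI fun b => by
        simp [inst] at ih ⊢
        refine .impI fun w₄ _ h => ?_
        have := ih.allE (succ b)
        simp [inst] at this
        exact this.mp (h₂ w₄ a b s h)) a
    simp [inst] at this
    have := this.allE b
    simp [inst] at this
    exact this.mp h
  have h₄ (a : PTm [] Ty.nat) : w₁ ⊩ attains f a zero a := by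
    have := Pr.induct (w := w₁) (attains f.wk v0 zero v0) (by
      simp [inst]; exact .exI zero (by simpa [inst] using hf₀)) (fun w₂ _ a ih => by
        simp [inst] at ih ⊢
        refine (h₃ w₂ a zero a ih).exE fun w₃ _ b hb => ?_
        simp [inst] at hb
        exact h₁ w₃ b a hb) a
    simpa [inst] using this
  -- Induction on `b` with `a` arbitrary: `(a, b + 1)` is reached one step after `(a + 1, b)`.
  have h₅ (a b : PTm [] Ty.nat) : w₁ ⊩ ex Ty.nat (attains f.wk a.wk b.wk v0) := by
    have := Pr.induct (w := w₁) (all Ty.nat (ex Ty.nat (attains f.wk.wk.wk v1 v2 v0)))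
      (.allI fun a => by
        simp [inst]; exact .exI a (by simpa [inst] using h₄ a)) (fun w₂ _ b ih => .allI fun a => by
        simp [inst] at ih ⊢
        have := ih.allE (succ a)
        simp [inst] at this
        refine this.exE fun w₃ _ s hs => .exI s ?_
        simp [inst] at hs ⊢
        exact h₂ w₃ a b s hs) b
    have := this.allE a
    simpa [inst] using this
  refine k w₁ (lam (fst (f.wk ⬝ₚ v0))) (lam (fst (snd (f.wk ⬝ₚ v0)))) fun a b => ?_
  refine (h₅ a b).exE fun w₂ _ s hs => ?_
  simp [inst] at hs
  refine hs.exE fun w₃ _ n hn => .exI n ?_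
  simp [inst] at hn ⊢
  have e₁ := Pr.beta (w := w₃) (fst (f.wk ⬝ₚ v0)) n
  have e₂ := Pr.beta (w := w₃) (fst (snd (f.wk ⬝ₚ v0))) n
  simp [inst] at e₁ e₂
  exact .andI (e₁.trans ((Pr.fst_congr hn).trans (.fst_pair _ _)))
    (e₂.trans ((Pr.fst_congr ((Pr.snd_congr hn).trans (.snd_pair _ _))).trans (.fst_pair _ _)))

/-! ### Semidecidable truth values -/

theorem Pr.iff_trans {p q r : PFm []} (h : w ⊩ p ⇔ₚ q) (h' : w ⊩ q ⇔ₚ r) : w ⊩ p ⇔ₚ r :=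
  .iffI (fun _ _ hp => h'.iff_mp (h.iff_mp hp)) fun _ _ hr => h.iff_mpr (h'.iff_mpr hr)

theorem inSigmaI {p : PFm []} (f : PTm [] (Ty.nat ⟶ₜ Ty.nat)) (hf : w ⊩ isBinary f)
    (h : w ⊩ p ⇔ₚ hasOne f) : w ⊩ inSigma p :=
  .exI f (by simpa [inst] using .andI hf h)

theorem inSigmaE {p χ : PFm []} (h : v ⊩ inSigma p) [Up v w]
    (k : ∀ (w' : World) [Ext w w'] (f : PTm [] (Ty.nat ⟶ₜ Ty.nat)), w' ⊩ isBinary f →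
      w' ⊩ p ⇔ₚ hasOne f → w' ⊩ χ) : w ⊩ χ :=
  h.exE fun w' _ f hf => by
    simp [inst] at hf
    exact k w' f hf.left hf.right

theorem isBinary_cases {f : PTm [] (Ty.nat ⟶ₜ Ty.nat)} (h : w ⊩ isBinary f) (n : PTm [] Ty.nat) :
    w ⊩ (f ⬝ₚ n ≐ₚ zero) ⊔ₚ (f ⬝ₚ n ≐ₚ succ zero) := by
  simpa [inst] using h.allE n

theorem hasOneI {f : PTm [] (Ty.nat ⟶ₜ Ty.nat)} (n : PTm [] Ty.nat) (h : w ⊩ f ⬝ₚ n ≐ₚ succ zero) :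
    w ⊩ hasOne f := .exI n (by simpa [inst] using h)

theorem hasOneE {f : PTm [] (Ty.nat ⟶ₜ Ty.nat)} {χ : PFm []} (h : v ⊩ hasOne f) [Up v w]
    (k : ∀ (w' : World) [Ext w w'] (n : PTm [] Ty.nat), w' ⊩ f ⬝ₚ n ≐ₚ succ zero → w' ⊩ χ) :
    w ⊩ χ := h.exE fun w' _ n hn => k w' n (by simpa [inst] using hn)

theorem const_apply (a n : PTm [] Ty.nat) : w ⊩ lam a.wk ⬝ₚ n ≐ₚ a := by
  simpa [inst] using Pr.beta (w := w) a.wk n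

theorem isBinary_const_zero : w ⊩ isBinary (lam zero.wk) :=
  .allI fun n => by simpa [inst] using .inl (const_apply zero n)

theorem isBinary_const_one : w ⊩ isBinary (lam (succ zero).wk) :=
  .allI fun n => by simpa [inst] using .inr (const_apply (succ zero) n)

/-- Decidable truth values are semidecidable. -/
theorem inSigma_of_dec {p : PFm []} (h : w ⊩ p ⊔ₚ neg p) : w ⊩ inSigma p :=
  h.orE
    (fun _ _ h => inSigmaI (lam (succ zero).wk) isBinary_const_one
      (.iffI (fun _ _ _ => hasOneI zero (const_apply _ _)) fun _ _ _ => h.up))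
    fun _ _ h => inSigmaI (lam zero.wk) isBinary_const_zero
      (.iffI (fun _ _ hp => h.absurd hp) fun _ _ h' => hasOneE h' fun _ _ n hn =>
        .succ_ne_zero (hn.symm.trans (const_apply zero n)))

theorem inSigma_congr {p q : PFm []} (h : w ⊩ p ⇔ₚ q) (hp : w ⊩ inSigma p) : w ⊩ inSigma q :=
  inSigmaE hp fun _ _ f hf hpf => inSigmaI f hf (h.iff_symm.up.iff_trans hpf)

/-- Markov's principle for semidecidable truth values. -/
theorem inSigma_stable {p : PFm []} (hp : w ⊩ inSigma p) (h : w ⊩ neg (neg p)) : w ⊩ p :=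
  inSigmaE hp fun _ _ f hf hpf => hpf.iff_mpr <| markov hf <| .negI fun _ _ h₀ =>
    h.absurd <| .negI fun _ _ hp => hasOneE (hpf.iff_mp hp) fun _ _ n hn =>
      .succ_ne_zero (hn.symm.trans (by simpa [inst] using h₀.up.allE n))

/-- A choice of binary sequences that witness that `S ∈ Σ^ℕ`. -/
theorem inSigma_choice {S : PTm [] PN} (h : ∀ n, w ⊩ inSigma (S ⬝ₚ n)) {χ : PFm []}
    (k : ∀ (w' : World) [Ext w w'] (F : PTm [] (Ty.nat ⟶ₜ Ty.nat ⟶ₜ Ty.nat)),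
      (∀ n, w' ⊩ isBinary (F ⬝ₚ n)) → (∀ n, w' ⊩ S ⬝ₚ n ⇔ₚ hasOne (F ⬝ₚ n)) → w' ⊩ χ) : w ⊩ χ := by
  refine countableChoice (lam (lam (isBinary v0 ⊓ₚ (S.wk.wk ⬝ₚ v1 ⇔ₚ hasOne v0)))) (fun n => ?_)
    fun w₁ _ F hF => ?_
  · refine inSigmaE (h n) fun w₁ _ f hf hpf => .exI f ?_
    simp [inst] at hpf ⊢
    exact mem_lam₂.2 (by simpa [inst] using .andI hf hpf)
  · have h₁ (n : PTm [] Ty.nat) : w₁ ⊩ isBinary (F ⬝ₚ n) ⊓ₚ (S ⬝ₚ n ⇔ₚ hasOne (F ⬝ₚ n)) := by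
      simpa [inst] using mem_lam₂.1 (hF n)
    exact k w₁ F (fun n => (h₁ n).left) fun n => (h₁ n).right

/-- A countable union of semidecidable truth values is semidecidable. -/
theorem inSigma_ex (φ : PFm [Ty.nat]) (h : ∀ n, w ⊩ inSigma (φ.inst n)) : w ⊩ inSigma (ex Ty.nat φ) := by
  have hφ (n) (w' : World) : w' ⊩ φ.inst n ⇔ₚ lam φ ⬝ₚ n :=
    .iffI (fun _ _ => Pr.mem_lam.2) fun _ _ => Pr.mem_lam.1
  refine inSigma_choice (fun n => inSigma_congr (hφ n w) (h n)) fun w₁ _ F hb hF => pairing fun w₂ _ r s hrs => ?_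
  have hF' (n) := (hφ n w₁).iff_trans (hF n)
  have e (n : PTm [] Ty.nat) (w' : World) : w' ⊩ lam (F.wk ⬝ₚ (r.wk ⬝ₚ v0) ⬝ₚ (s.wk ⬝ₚ v0)) ⬝ₚ n ≐ₚ
      F ⬝ₚ (r ⬝ₚ n) ⬝ₚ (s ⬝ₚ n) := by
    simpa [inst] using Pr.beta (w := w') (F.wk ⬝ₚ (r.wk ⬝ₚ v0) ⬝ₚ (s.wk ⬝ₚ v0)) n
  -- Dovetailing: stage `k` runs the search for the index `r k` at its step `s k`.
  refine inSigmaI (lam (F.wk ⬝ₚ (r.wk ⬝ₚ v0) ⬝ₚ (s.wk ⬝ₚ v0))) (.allI fun n => ?_)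
    (.iffI (fun w₃ _ h => h.exE fun w₄ _ n hn => hasOneE ((hF' n).iff_mp hn) fun w₅ _ m hm =>
      (hrs n m).exE fun w₆ _ k hk => hasOneI k ?_) fun w₃ _ h => hasOneE h fun w₄ _ n hn => .exI (r ⬝ₚ n) ?_)
  · simp [inst]
    exact (isBinary_cases (hb (r ⬝ₚ n)) (s ⬝ₚ n)).orE (fun w₃ _ h => .inl ((e n w₃).trans h))
      fun w₃ _ h => .inr ((e n w₃).trans h)
  · simp [inst] at hk
    exact (e k w₆).trans ((Pr.app_congr (.arg_congr hk.left) hk.right).trans hm.up)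
  · exact (hF' _).iff_mpr (hasOneI (s ⬝ₚ n) ((e n w₄).symm.trans hn))

/-- The dominance property: a conjunction is semidecidable if the second conjunct is so whenever the
first one holds. -/
theorem inSigma_and {p q : PFm []} (hp : w ⊩ inSigma p) (hq : w ⊩ p ⇒ₚ inSigma q) :
    w ⊩ inSigma (p ⊓ₚ q) := by
  refine inSigmaE hp fun w₁ _ f hf hpf => ?_
  -- The conjunction is rewritten as a countable union over the steps of the search for `p`. At each
  -- step `f n = 1` is decidable, and if it holds then so does `p`, which makes `q` semidecidable.
  have h : w₁ ⊩ inSigma (ex Ty.nat ((f.wk ⬝ₚ v0 ≐ₚ succ zero) ⊓ₚ q.wk)) := by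
    refine inSigma_ex _ fun n => ?_
    simp [inst]
    refine (nat_dec (w := w₁) (f ⬝ₚ n) (succ zero)).orE (fun w₂ _ h => ?_) fun w₂ _ h => inSigma_of_dec (.inr (.negI
      fun w₃ _ h' => h.absurd h'.left))
    exact inSigma_congr (.iffI (fun _ _ h' => .andI h.up h') fun _ _ h' => h'.right)
      (hq.mp (hpf.iff_mpr (hasOneI n h)))
  refine inSigma_congr (.iffI (fun w₂ _ h => ?_) fun w₂ _ h => ?_) h
  · refine h.exE fun w₃ _ n hn => ?_
    simp [inst] at hn
    exact .andI (hpf.iff_mpr (hasOneI n hn.left)) hn.right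
  · refine hasOneE (hpf.iff_mp h.left) fun w₃ _ n hn => .exI n ?_
    simp [inst]
    exact .andI hn h.right.up

/-- A binary disjunction is a countable union that has `p` at index zero and `q` at every other
index. -/
theorem inSigma_or {p q : PFm []} (hp : w ⊩ inSigma p) (hq : w ⊩ inSigma q) :
    w ⊩ inSigma (p ⊔ₚ q) := by
  have h : w ⊩ inSigma (ex Ty.nat (((v0 ≐ₚ zero) ⊓ₚ p.wk) ⊔ₚ (neg (v0 ≐ₚ zero) ⊓ₚ q.wk))) := by
    refine inSigma_ex _ fun n => ?_
    simp [inst]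
    refine (nat_dec (w := w) n zero).orE (fun w₁ _ h => inSigma_congr (.iffI (fun w₂ _ h' => .inl
      (.andI h.up h')) fun w₂ _ h' => h'.orE (fun _ _ h' => h'.right) fun _ _ h' =>
        h'.left.absurd h.up) hp.up)
      fun w₁ _ h => inSigma_congr (.iffI (fun w₂ _ h' => .inr (.andI h.up h'))
        fun w₂ _ h' => h'.orE (fun _ _ h' => h.absurd h'.left) fun _ _ h' => h'.right) hq.up
  refine inSigma_congr (.iffI (fun w₁ _ h => ?_) fun w₁ _ h => ?_) h
  · refine h.exE fun w₂ _ n hn => ?_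
    simp [inst] at hn
    exact hn.orE (fun _ _ h => .inl h.right) fun _ _ h => .inr h.right
  · refine h.orE (fun w₂ _ h => .exI zero ?_) fun w₂ _ h => .exI (succ zero) ?_
    · simpa [inst] using .inl (.andI .rfl h)
    · simpa [inst] using .inr (.andI (.negI fun _ _ h => .succ_ne_zero h) h)

theorem inSigma_true {p : PFm []} (h : w ⊩ p) : w ⊩ inSigma p := inSigma_of_dec (.inl h)

theorem inSigma_false {p : PFm []} (h : w ⊩ neg p) : w ⊩ inSigma p := inSigma_of_dec (.inr h)

/-- Semidecidable truth values are not closed under negation. -/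
theorem not_inSigma_neg {χ : PFm []} (h : ∀ p, w ⊩ inSigma p ⇒ₚ inSigma (neg p)) : w ⊩ χ := by
  refine enumerability fun w₁ _ W hW hsurj => ?_
  -- Cantor's diagonal set `{n | n ∉ W n}`, semidecidable by the assumption on negations.
  have hD : w₁ ⊩ inSigmaN (lam (neg (W.wk ⬝ₚ v0 ⬝ₚ v0))) := .allI fun n => by
    have h₁ := (hW n).allE n
    have h₂ : w₁ ⊩ neg (W ⬝ₚ n ⬝ₚ n) ⇔ₚ lam (neg (W.wk ⬝ₚ v0 ⬝ₚ v0)) ⬝ₚ n := .iffI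
      (fun _ _ h => Pr.mem_lam.2 (by simpa [inst] using h))
      fun _ _ h => by simpa [inst] using Pr.mem_lam.1 h
    simp [inst] at h₁ ⊢
    exact inSigma_congr h₂ ((h _).mp h₁)
  refine ((hsurj _).mp hD).exE fun w₂ _ k hk => ?_
  simp [inst] at hk
  have h₁ : w₂ ⊩ neg (W ⬝ₚ k ⬝ₚ k) := .negI fun w₃ _ h => by
    have := Pr.mem_lam.1 (Pr.mem_of_eq hk h)
    simp [inst] at this
    exact this.absurd h
  exact h₁.absurd (Pr.mem_of_eq hk.symm (Pr.mem_lam.2 (by simpa [inst] using h₁)))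

/-! ### Semidecidable and finite subsets of `ℕ` -/

theorem inSigmaN_apply {S : PTm [] PN} (h : w ⊩ inSigmaN S) (n : PTm [] Ty.nat) :
    w ⊩ inSigma (S ⬝ₚ n) := by simpa [inst] using h.allE n

theorem inSigmaNI {S : PTm [] PN} (h : ∀ n, w ⊩ inSigma (S ⬝ₚ n)) : w ⊩ inSigmaN S :=
  .allI fun n => by simpa [inst] using h n

theorem inSigmaN_lam (φ : PFm [Ty.nat]) (h : ∀ n, w ⊩ inSigma (φ.inst n)) : w ⊩ inSigmaN (lam φ) :=
  inSigmaNI fun n => inSigma_congr (.iffI (fun _ _ => Pr.mem_lam.2) fun _ _ => Pr.mem_lam.1) (h n)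

theorem subsetI {S T : PTm [] PN}
    (h : ∀ (w' : World) [Ext w w'] (n : PTm [] Ty.nat), w' ⊩ S ⬝ₚ n → w' ⊩ T ⬝ₚ n) :
    w ⊩ subset S T := .allI fun n => by
  simp [inst]
  exact .impI fun w' _ hn => h w' n hn

theorem mem_of_subset {S T : PTm [] PN} (h : v ⊩ subset S T) [Up v w] {n : PTm [] Ty.nat}
    (hn : w ⊩ S ⬝ₚ n) : w ⊩ T ⬝ₚ n := by
  have := h.allE n
  simp [inst] at this
  exact this.mp hn

theorem subset_congr {S S' T T' : PTm [] PN} (h : w ⊩ S ≐ₚ S') (h' : w ⊩ T ≐ₚ T')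
    (hST : w ⊩ subset S T) : w ⊩ subset S' T' :=
  subsetI fun _ _ _ hn => Pr.mem_of_eq h' (mem_of_subset hST (Pr.mem_of_eq h.symm hn))

theorem inSigmaN_congr {S T : PTm [] PN} (h : w ⊩ S ≐ₚ T) (hS : w ⊩ inSigmaN S) : w ⊩ inSigmaN T := by
  have := Pr.rewrite (inSigmaN v0) h (by simpa [inst] using hS)
  simpa [inst] using this

theorem isFinite_congr {S T : PTm [] PN} (h : w ⊩ S ≐ₚ T) (hS : w ⊩ isFinite S) : w ⊩ isFinite T := by
  have := Pr.rewrite (isFinite v0) h (by simpa [inst] using hS)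
  simpa [inst] using this

theorem mem_emptySet {n : PTm [] Ty.nat} {χ : PFm []} (h : w ⊩ emptySet ⬝ₚ n) : w ⊩ χ :=
  .botE (by simpa [inst] using Pr.mem_lam.1 h)

theorem mem_insert {S : PTm [] PN} {m n : PTm [] Ty.nat} :
    (w ⊩ insert S n ⬝ₚ m) ↔ w ⊩ S ⬝ₚ m ⊔ₚ (m ≐ₚ n) := by
  rw [insert, Pr.mem_lam]; simp [inst]

theorem isFinite_induction (φ : PFm [PN]) {T : PTm [] PN} (h : w ⊩ isFinite T)
    (h₀ : w ⊩ φ.inst emptySet)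
    (h₁ : ∀ (w' : World) [Ext w w'] (S : PTm [] PN) (n : PTm [] Ty.nat),
      w' ⊩ φ.inst S → w' ⊩ φ.inst (insert S n)) : w ⊩ φ.inst T := by
  have := h.allE (lam φ)
  simp only [inst, subst_imp, subst_all, subst_app, subst_var_eq, one_z, subst_emptySet, lift_s,
    lift_z, wk_var, subst_insert, wk_subst_one] at this
  refine Pr.mem_lam.1 ((this.mp (Pr.mem_lam.2 h₀)).mp (.allI fun S => .allI fun n => ?_))
  simp only [inst, subst_imp, subst_app, subst_var_eq, one_z, lift_s,
    lift_z, subst_insert, wk_subst_one, wk_subst_lift]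
  exact .impI fun w' _ hS => Pr.mem_lam.2 (h₁ w' S n (Pr.mem_lam.1 hS))

theorem isFinite_emptySet : w ⊩ isFinite emptySet := .allI fun P => by
  simp only [inst, subst_imp, subst_all, subst_app, subst_var_eq, one_z, subst_emptySet, lift_s,
    lift_z, wk_var, subst_insert, wk_subst_one]
  exact .impI fun _ _ h => .impI fun _ _ _ => h.up

theorem isFinite_insert {S : PTm [] PN} (h : w ⊩ isFinite S) (n : PTm [] Ty.nat) :
    w ⊩ isFinite (insert S n) := .allI fun P => by
  have := h.allE P
  simp [inst] at this ⊢
  refine .impI fun w₁ _ h₀ => .impI fun w₂ _ h₁ => ?_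
  have h₂ := (h₁.allE S).allE n
  simp [inst] at h₂
  exact h₂.mp ((this.mp h₀).mp h₁)

theorem inSigmaN_of_isFinite {T : PTm [] PN} (h : w ⊩ isFinite T) : w ⊩ inSigmaN T := by
  have := isFinite_induction (inSigmaN v0) h
    (by simpa [inst] using inSigmaNI fun n => inSigma_false (.negI fun _ _ => mem_emptySet))
    fun w₁ _ S n hS => by
      simp [inst] at hS ⊢
      refine inSigmaNI fun m => inSigma_congr (.iffI (fun _ _ => mem_insert.2) fun _ _ => mem_insert.1)
        (inSigma_or (inSigmaN_apply hS m) (inSigma_of_dec (nat_dec _ _)))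
  simpa [inst] using this

/-- Inclusion of a finite set in a semidecidable set is semidecidable. -/
theorem inSigma_subset {S T : PTm [] PN} (h : w ⊩ isFinite T) (hS : w ⊩ inSigmaN S) :
    w ⊩ inSigma (subset T S) := by
  have := isFinite_induction (inSigma (subset v0 S.wk)) h
    (by simpa [inst] using inSigma_true (subsetI fun _ _ _ => mem_emptySet))
    fun w₁ _ T n hT => by
      simp [inst] at hT ⊢
      refine inSigma_congr (.iffI (fun w₂ _ h => subsetI fun w₃ _ m hm => ?_) fun w₂ _ h => .andI
        (subsetI fun w₃ _ m hm => mem_of_subset h (mem_insert.2 (.inl hm)))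
        (mem_of_subset h (mem_insert.2 (.inr .rfl))))
        (inSigma_and hT (.impI fun w₂ _ _ => inSigmaN_apply hS.up n))
      exact (mem_insert.1 hm).orE (fun _ _ hm => mem_of_subset h.left hm) fun _ _ hm =>
        Pr.mem_congr hm.symm h.right.up
  simpa [inst] using this

/-! ### Chains -/

theorem isChain_apply {c : PTm [] (Ty.nat ⟶ₜ PN)} (h : w ⊩ isChain c) (n : PTm [] Ty.nat) :
    w ⊩ inSigmaN (c ⬝ₚ n) := by simpa [inst] using h.left.allE n

theorem isChain_succ {c : PTm [] (Ty.nat ⟶ₜ PN)} (h : w ⊩ isChain c) (n : PTm [] Ty.nat) :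
    w ⊩ subset (c ⬝ₚ n) (c ⬝ₚ succ n) := by simpa [inst] using h.right.allE n

theorem isChain_mono {c : PTm [] (Ty.nat ⟶ₜ PN)} (h : w ⊩ isChain c) {i k : PTm [] Ty.nat}
    (hik : w ⊩ lt i k) : w ⊩ subset (c ⬝ₚ i) (c ⬝ₚ k) := by
  have := lt_elim (subset (c.wk ⬝ₚ i.wk) (c.wk ⬝ₚ v0)) hik (by simpa [inst] using isChain_succ h i)
    fun w₁ _ n hn => by
      simp [inst] at hn ⊢
      exact subsetI fun w₂ _ m hm => mem_of_subset (isChain_succ h n) (mem_of_subset hn hm)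
  simpa [inst] using this

/-- The union of a sequence of subsets of `ℕ`. -/
def iUnion (c : PTm [] (Ty.nat ⟶ₜ PN)) : PTm [] PN := lam (ex Ty.nat (c.wk.wk ⬝ₚ v0 ⬝ₚ v1))

theorem mem_iUnionI {c : PTm [] (Ty.nat ⟶ₜ PN)} {n : PTm [] Ty.nat} (k : PTm [] Ty.nat)
    (h : w ⊩ c ⬝ₚ k ⬝ₚ n) : w ⊩ iUnion c ⬝ₚ n :=
  Pr.mem_lam.2 (.exI k (by simpa [inst] using h))

theorem mem_iUnionE {c : PTm [] (Ty.nat ⟶ₜ PN)} {n : PTm [] Ty.nat} {χ : PFm []}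
    (h : v ⊩ iUnion c ⬝ₚ n) [Up v w]
    (hk : ∀ (w' : World) [Ext w w'] (k : PTm [] Ty.nat), w' ⊩ c ⬝ₚ k ⬝ₚ n → w' ⊩ χ) : w ⊩ χ :=
  (Pr.mem_lam.1 h).exE fun w' _ k h => hk w' k (by simpa [inst] using h)

theorem inSigmaN_iUnion {c : PTm [] (Ty.nat ⟶ₜ PN)} (h : w ⊩ isChain c) : w ⊩ inSigmaN (iUnion c) :=
  inSigmaN_lam _ fun n => inSigma_ex _ fun k => by
    simpa [inst] using inSigmaN_apply (isChain_apply h k) n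

/-- `f i = 0` for all `i < k` -/
def vanishesBelow {Γ : Ctx} (f : PTm Γ (Ty.nat ⟶ₜ Ty.nat)) (k : PTm Γ Ty.nat) : PFm Γ :=
  all Ty.nat (lt v0 k.wk ⇒ₚ f.wk ⬝ₚ v0 ≐ₚ zero)

@[simp] theorem subst_vanishesBelow {Γ Δ : Ctx} (σ : PSub Γ Δ) (f : PTm Γ (Ty.nat ⟶ₜ Ty.nat))
    (k : PTm Γ Ty.nat) : (vanishesBelow f k).subst σ = vanishesBelow (f.subst σ) (k.subst σ) := by
  simp [vanishesBelow]

theorem vanishesBelowI {f : PTm [] (Ty.nat ⟶ₜ Ty.nat)} {k : PTm [] Ty.nat}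
    (h : ∀ (w' : World) [Ext w w'] (i : PTm [] Ty.nat), w' ⊩ lt i k → w' ⊩ f ⬝ₚ i ≐ₚ zero) :
    w ⊩ vanishesBelow f k := .allI fun i => by
  simp [inst]
  exact .impI fun w' _ hi => h w' i hi

theorem vanishesBelow_apply {f : PTm [] (Ty.nat ⟶ₜ Ty.nat)} {i k : PTm [] Ty.nat}
    (h : v ⊩ vanishesBelow f k) [Up v w] (hi : w ⊩ lt i k) : w ⊩ f ⬝ₚ i ≐ₚ zero := by
  have := h.allE i
  simp [inst] at this
  exact this.mp hi

/-- A bounded search over decidable equations, by induction on the bound. It keeps the test set in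
`intrinsicOpen_chain` semidecidable. -/
theorem vanishesBelow_dec (f : PTm [] (Ty.nat ⟶ₜ Ty.nat)) (k : PTm [] Ty.nat) :
    w ⊩ vanishesBelow f k ⊔ₚ neg (vanishesBelow f k) := by
  have := Pr.induct (w := w) (vanishesBelow f.wk v0 ⊔ₚ neg (vanishesBelow f.wk v0))
    (by simpa [inst] using .inl (vanishesBelowI fun _ _ _ h => lt_zero h)) (fun w₁ _ k hk => by
      simp [inst] at hk ⊢
      refine hk.orE (fun w₂ _ h => (nat_dec (w := w₂) (f ⬝ₚ k) zero).orE (fun w₃ _ h' => .inl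
        (vanishesBelowI fun w₄ _ i hi => (lt_succ_cases hi).orE (fun _ _ hi => vanishesBelow_apply h hi)
          fun _ _ hi => (Pr.arg_congr hi).trans h'.up)) fun w₃ _ h' => .inr (.negI fun w₄ _ h'' =>
            h'.absurd (vanishesBelow_apply h'' (lt_succ_self k)))) fun w₂ _ h => .inr (.negI fun w₃ _ h' =>
              h.absurd (vanishesBelowI fun w₄ _ i hi => vanishesBelow_apply h' (lt_succ hi)))) k
  simpa [inst] using this

/-! ### Open sets -/

theorem intrinsicOpen_apply {U : PTm [] PPN} (h : v ⊩ intrinsicOpen U) [Up v w] {S : PTm [] PN}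
    (hS : w ⊩ inSigmaN S) : w ⊩ inSigma (U ⬝ₚ S) := by
  have := h.allE S
  simp [inst] at this
  exact this.mp hS

/-- Open sets are upward closed. -/
theorem intrinsicOpen_upper {U : PTm [] PPN} (hU : v ⊩ intrinsicOpen U) [Up v w] {S T : PTm [] PN}
    (hS : w ⊩ inSigmaN S) (hT : w ⊩ inSigmaN T) (h : w ⊩ U ⬝ₚ S) (hST : w ⊩ subset S T) :
    w ⊩ U ⬝ₚ T := by
  -- Markov's principle permits arguing by contradiction; the contradiction is that every `¬p`
  -- becomes semidecidable.
  refine inSigma_stable (intrinsicOpen_apply hU hT) (.negI fun w₁ _ hUT => not_inSigma_neg fun p =>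
    .impI fun w₂ _ hp => ?_)
  -- The test set `S ∪ {n ∈ T | p}` equals `T` if `p` holds and `S` if `p` fails.
  have hSp : w₂ ⊩ inSigmaN (lam (S.wk ⬝ₚ v0 ⊔ₚ (T.wk ⬝ₚ v0 ⊓ₚ p.wk))) := inSigmaN_lam _ fun n => by
    simpa [inst] using inSigma_or (inSigmaN_apply hS.up n) (inSigma_and (inSigmaN_apply hT.up n)
      (.impI fun _ _ _ => hp.up))
  have hmem {w' : World} {n : PTm [] Ty.nat} : (w' ⊩ lam (S.wk ⬝ₚ v0 ⊔ₚ (T.wk ⬝ₚ v0 ⊓ₚ p.wk)) ⬝ₚ n) ↔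
      w' ⊩ S ⬝ₚ n ⊔ₚ (T ⬝ₚ n ⊓ₚ p) := by rw [Pr.mem_lam]; simp [inst]
  refine inSigma_congr (.iffI (fun w₃ _ h' => .negI fun w₄ _ hp => hUT.absurd
    (Pr.mem_congr (v := w₄) (.setext fun n => .iffI (fun w₅ _ hn => ?_) fun w₅ _ hn => ?_) h'.up)) fun w₃ _ h' =>
    Pr.mem_congr (v := w₃) (.setext fun n => .iffI (fun w₄ _ hn => ?_) fun w₄ _ hn => ?_) h.up)
    (intrinsicOpen_apply hU hSp)
  · exact (hmem.1 hn).orE (fun _ _ h => mem_of_subset hST h) fun _ _ h => h.left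
  · exact hmem.2 (.inr (.andI hn hp.up))
  · exact hmem.2 (.inl hn)
  · exact (hmem.1 hn).orE (fun _ _ h => h) fun _ _ hn => h'.absurd hn.right

/-- Open sets are inaccessible by unions of chains. -/
theorem intrinsicOpen_chain {U : PTm [] PPN} (hU : w ⊩ intrinsicOpen U) {c : PTm [] (Ty.nat ⟶ₜ PN)}
    (hc : w ⊩ isChain c) {S : PTm [] PN} (hS : w ⊩ inSigmaN S) (hSc : w ⊩ subset S (iUnion c))
    (h : w ⊩ U ⬝ₚ S) : w ⊩ ex Ty.nat (U.wk ⬝ₚ (c.wk ⬝ₚ v0)) := by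
  refine inSigma_stable (inSigma_ex _ fun n => by
    simpa [inst] using intrinsicOpen_apply hU (isChain_apply hc n)) (.negI fun w₁ _ hno =>
      not_inSigma_neg fun p => .impI fun w₂ _ hp => inSigmaE hp fun w₃ _ g hg hpg => ?_)
  -- The test set follows the chain `c` for as long as the search for a one in `g` has not
  -- succeeded.
  let φ : PFm [Ty.nat] := ex Ty.nat (c.wk.wk ⬝ₚ v0 ⬝ₚ v1 ⊓ₚ vanishesBelow g.wk.wk v0)
  have hφ : w₃ ⊩ inSigmaN (lam φ) := inSigmaN_lam _ fun n => inSigma_ex _ fun k => by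
    simpa [inst] using inSigma_and (inSigmaN_apply (isChain_apply hc.up k) n)
      (.impI fun _ _ _ => inSigma_of_dec (vanishesBelow_dec g k))
  refine inSigma_congr (.iffI (fun w₄ _ h' => .negI fun w₅ _ hp => ?_) fun w₄ _ h' => ?_)
    (intrinsicOpen_apply hU hφ)
  -- If `g m = 1`, then `g` can vanish below `k` only for `k ≤ m`, so the test set is contained in
  -- `c m`; upward closure would put `c m` in `U`.
  · refine hasOneE (hpg.iff_mp hp) fun w₆ _ m hm => hno.absurd (.exI m ?_)
    simp [inst]
    refine intrinsicOpen_upper hU hφ.up (isChain_apply hc.up m) h'.up (subsetI fun w₇ _ n hn =>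
      (Pr.mem_lam.1 hn).exE fun w₈ _ k hk => ?_)
    simp [inst] at hk
    refine (lt_total (w := w₈) k m).orE (fun w₉ _ hkm => mem_of_subset (isChain_mono hc.up hkm)
      hk.left.up) fun w₉ _ hmk => (lt_succ_cases hmk).orE (fun w₁₀ _ hmk => ?_) fun w₁₀ _ hmk => ?_
    · exact .succ_ne_zero (hm.up.symm.trans (vanishesBelow_apply hk.right hmk))
    · exact Pr.mem_of_eq (.arg_congr hmk.symm) hk.left.up
  -- If `p` fails, `g` vanishes everywhere, so the test set contains the union of the chain and
  -- hence `S`.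
  · refine intrinsicOpen_upper hU hS.up hφ.up h.up (subsetI fun w₅ _ n hn => ?_)
    refine mem_iUnionE (mem_of_subset hSc hn) fun w₆ _ k hk => Pr.mem_lam.2 (.exI k ?_)
    simp [inst]
    refine .andI hk (vanishesBelowI fun w₇ _ i _ => ?_)
    exact (isBinary_cases (hg.up (w := w₇)) i).orE (fun _ _ h => h) fun _ _ hi =>
      h'.absurd (hpg.iff_mpr (hasOneI i hi))

theorem isUpper_of_intrinsicOpen {U : PTm [] PPN} (hU : w ⊩ intrinsicOpen U) : w ⊩ isUpper U :=
  .allI fun S => .allI fun T => by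
    simp [inst]
    exact .impI fun w₁ _ hS => .impI fun w₂ _ hT => .impI fun w₃ _ h => .impI fun w₄ _ hST =>
      intrinsicOpen_upper hU hS.up hT.up h.up hST

/-- The union of the chain is a semidecidable upper bound, so the supremum is contained in it. -/
theorem inaccessible_of_intrinsicOpen {U : PTm [] PPN} (hU : w ⊩ intrinsicOpen U) :
    w ⊩ inaccessible U := .allI fun c => .allI fun S => by
  simp [inst]
  refine .impI fun w₁ _ hc => .impI fun w₂ _ hS => .impI fun w₃ _ h => ?_
  have h₁ := hS.right.right.allE (iUnion c)
  simp [inst] at h₁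
  refine intrinsicOpen_chain (hU.up (w := w₃)) hc.up hS.left.up ?_ h
  refine (h₁.mp (w := w₃) (inSigmaN_iUnion hc.up)).mp (.allI fun k => ?_)
  simp [inst]
  exact subsetI fun w₄ _ n hn => mem_iUnionI k hn

/-! ### Finite approximations -/

/-- The finite set of all `r i` with `i < b` and `f (r i) (s i) = 1`. -/
def approx {Γ : Ctx} (f : PTm Γ (Ty.nat ⟶ₜ Ty.nat ⟶ₜ Ty.nat)) (r s : PTm Γ (Ty.nat ⟶ₜ Ty.nat))
    (b : PTm Γ Ty.nat) : PTm Γ PN :=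
  lam (ex Ty.nat (lt v0 b.wk.wk ⊓ₚ (r.wk.wk ⬝ₚ v0 ≐ₚ v1) ⊓ₚ
    (f.wk.wk ⬝ₚ v1 ⬝ₚ (s.wk.wk ⬝ₚ v0) ≐ₚ succ zero)))

@[simp] theorem subst_approx {Γ Δ : Ctx} (σ : PSub Γ Δ) (f : PTm Γ (Ty.nat ⟶ₜ Ty.nat ⟶ₜ Ty.nat))
    (r s : PTm Γ (Ty.nat ⟶ₜ Ty.nat)) (b : PTm Γ Ty.nat) :
    (approx f r s b).subst σ = approx (f.subst σ) (r.subst σ) (s.subst σ) (b.subst σ) := by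
  simp [approx]

section
variable {f : PTm [] (Ty.nat ⟶ₜ Ty.nat ⟶ₜ Ty.nat)} {r s : PTm [] (Ty.nat ⟶ₜ Ty.nat)}
  {b n : PTm [] Ty.nat}

theorem mem_approxI (i : PTm [] Ty.nat) (h₁ : w ⊩ lt i b) (h₂ : w ⊩ r ⬝ₚ i ≐ₚ n)
    (h₃ : w ⊩ f ⬝ₚ n ⬝ₚ (s ⬝ₚ i) ≐ₚ succ zero) : w ⊩ approx f r s b ⬝ₚ n :=
  Pr.mem_lam.2 (.exI i (by simpa [inst] using .andI h₁ (.andI h₂ h₃)))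

theorem mem_approxE {χ : PFm []} (h : v ⊩ approx f r s b ⬝ₚ n) [Up v w]
    (k : ∀ (w' : World) [Ext w w'] (i : PTm [] Ty.nat), w' ⊩ lt i b → w' ⊩ r ⬝ₚ i ≐ₚ n →
      w' ⊩ f ⬝ₚ n ⬝ₚ (s ⬝ₚ i) ≐ₚ succ zero → w' ⊩ χ) : w ⊩ χ :=
  (Pr.mem_lam.1 h).exE fun w' _ i hi => by
    simp [inst] at hi
    exact k w' i hi.left hi.right.left hi.right.right

theorem subset_approx_succ : w ⊩ subset (approx f r s b) (approx f r s (succ b)) :=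
  subsetI fun _ _ _ hn => mem_approxE hn fun _ _ i h₁ h₂ h₃ => mem_approxI i (lt_succ h₁) h₂ h₃

/-- Stage `b + 1` either adds the element `r b` to stage `b` or equals it, according to the
decidable equation `f (r b) (s b) = 1`. -/
theorem isFinite_approx (f : PTm [] (Ty.nat ⟶ₜ Ty.nat ⟶ₜ Ty.nat)) (r s : PTm [] (Ty.nat ⟶ₜ Ty.nat))
    (b : PTm [] Ty.nat) : w ⊩ isFinite (approx f r s b) := by
  have := Pr.induct (w := w) (isFinite (approx f.wk r.wk s.wk v0)) (by
      simp [inst]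
      exact isFinite_congr (.setext fun n => .iffI (fun _ _ => mem_emptySet) fun _ _ h =>
        mem_approxE h fun _ _ i h₁ _ _ => lt_zero h₁) isFinite_emptySet) (fun w₁ _ b hb => by
      simp [inst] at hb ⊢
      refine (nat_dec (w := w₁) (f ⬝ₚ (r ⬝ₚ b) ⬝ₚ (s ⬝ₚ b)) (succ zero)).orE (fun w₂ _ h => ?_)
        fun w₂ _ h => ?_
      · refine isFinite_congr (.setext fun n => .iffI (fun w₃ _ hn => (mem_insert.1 hn).orE
          (fun w₄ _ hn => mem_of_subset (v := w₄) subset_approx_succ hn) fun w₄ _ hn => ?_) fun w₃ _ hn =>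
            mem_approxE hn fun w₄ _ i h₁ h₂ h₃ => mem_insert.2 ((lt_succ_cases h₁).orE (fun w₅ _ h₁ => .inl
              (mem_approxI i h₁ h₂.up h₃.up)) fun w₅ _ h₁ => .inr ?_)) (isFinite_insert hb.up (r ⬝ₚ b))
        · exact mem_approxI b (lt_succ_self b) hn.symm ((Pr.fun_congr (.arg_congr hn)).trans h.up)
        · exact h₂.symm.up.trans (.arg_congr h₁)
      · refine isFinite_congr (.setext fun n => .iffI (fun w₃ _ hn => mem_of_subset (v := w₃)
          subset_approx_succ hn) fun w₃ _ hn => mem_approxE hn fun w₄ _ i h₁ h₂ h₃ =>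
            (lt_succ_cases h₁).orE (fun w₅ _ h₁ => mem_approxI i h₁ h₂.up h₃.up) fun w₅ _ h₁ =>
              h.absurd ?_) hb.up
        have e := Pr.arg_congr (f := r) h₁.symm
        exact (Pr.app_congr (.arg_congr (e.trans h₂.up)) (.arg_congr h₁.symm)).trans h₃.up) b
  simpa [inst] using this

theorem approx_subset {S : PTm [] PN} (hf : ∀ n, w ⊩ S ⬝ₚ n ⇔ₚ hasOne (f ⬝ₚ n)) :
    w ⊩ subset (approx f r s b) S :=
  subsetI fun _ _ n hn => mem_approxE hn fun _ _ _ _ _ h => (hf n).iff_mpr (hasOneI _ h)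

/-- An open set that contains `S` contains a finite approximation of `S`. -/
theorem exists_approx_mem {U : PTm [] PPN} (hU : w ⊩ intrinsicOpen U)
    (hrs : ∀ a b : PTm [] Ty.nat, w ⊩ ex Ty.nat ((r.wk ⬝ₚ v0 ≐ₚ a.wk) ⊓ₚ (s.wk ⬝ₚ v0 ≐ₚ b.wk)))
    {S : PTm [] PN} (hS : w ⊩ inSigmaN S) (hf : ∀ n, w ⊩ S ⬝ₚ n ⇔ₚ hasOne (f ⬝ₚ n))
    (h : w ⊩ U ⬝ₚ S) : w ⊩ ex Ty.nat (U.wk ⬝ₚ approx f.wk r.wk s.wk v0) := by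
  have e (b : PTm [] Ty.nat) (w' : World) : w' ⊩ lam (approx f.wk r.wk s.wk v0) ⬝ₚ b ≐ₚ approx f r s b := by
    simpa [inst] using Pr.beta (w := w') (approx f.wk r.wk s.wk v0) b
  have hc : w ⊩ isChain (lam (approx f.wk r.wk s.wk v0)) := .andI
    (.allI fun b => by
      simpa [inst] using inSigmaN_congr (e b w).symm (inSigmaN_of_isFinite (isFinite_approx f r s b)))
    (.allI fun b => by
      simpa [inst] using subset_congr (e b w).symm (e _ w).symm subset_approx_succ)
  -- The stages exhaust `S`: if `f n m = 1` and `(r k, s k) = (n, m)`, then `n` has entered by stage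
  -- `k + 1`, since stages use strict bounds.
  refine (intrinsicOpen_chain hU hc hS (subsetI fun w₁ _ n hn => hasOneE ((hf n).iff_mp hn)
    fun w₂ _ m hm => (hrs n m).exE fun w₃ _ k hk => mem_iUnionI (succ k) ?_) h).exE fun w₁ _ b hb => .exI b ?_
  · simp [inst] at hk
    exact Pr.mem_of_eq (e _ w₃).symm (mem_approxI k (lt_succ_self k) hk.left
      ((Pr.arg_congr hk.right).trans hm.up))
  · simp [inst] at hb ⊢
    exact Pr.mem_congr (e b w₁) hb

end

theorem unionOfItsBasic_of_intrinsicOpen {U : PTm [] PPN} (hU : w ⊩ intrinsicOpen U) :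
    w ⊩ unionOfItsBasic U := .allI fun S => by
  simp [inst]
  refine .impI fun w₁ _ hS => .iffI (fun w₂ _ h => inSigma_choice (fun n => inSigmaN_apply hS.up n)
    fun w₃ _ f _ hf => pairing fun w₄ _ r s hrs => ?_) fun w₂ _ h => h.exE fun w₃ _ T hT => ?_
  · refine (exists_approx_mem (w := w₄) hU.up hrs hS.up (fun n => (hf n).up) h.up).exE
      fun w₅ _ b hb => .exI (approx f r s b) ?_
    simp [inst] at hb ⊢
    exact .andI (isFinite_approx _ _ _ _) (.andI (approx_subset fun n => (hf n).up) hb)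
  · simp [inst] at hT
    exact intrinsicOpen_upper hU (inSigmaN_of_isFinite hT.left) hS.up hT.right.right hT.right.left

/-- The basic sets come from all finite stages of all enumerated sets `W n`; the index set keeps the
stages that lie in `U`. -/
theorem countableUnionOfBasic_of_intrinsicOpen {U : PTm [] PPN} (hU : w ⊩ intrinsicOpen U) :
    w ⊩ countableUnionOfBasic U := by
  refine enumerability fun w₁ _ W hW hsurj => ?_
  -- Countable choice fixes search sequences for all the `W n` at once, so that their stages form
  -- one sequence of finite sets.
  refine countableChoice (lam (lam (all Ty.nat (W.wk.wk.wk ⬝ₚ v2 ⬝ₚ v0 ⇔ₚ hasOne (v1 ⬝ₚ v0)))))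
    (fun n => inSigma_choice (fun m => inSigmaN_apply (hW n) m) fun w₂ _ f _ hf => .exI f ?_)
    fun w₂ _ H hH => pairing fun w₃ _ r s hrs => ?_
  · simp [inst]
    refine mem_lam₂.2 ?_
    simp [inst]
    exact .allI fun m => by simpa [inst] using hf m
  have hH (n m : PTm [] Ty.nat) : w₂ ⊩ W ⬝ₚ n ⬝ₚ m ⇔ₚ hasOne (H ⬝ₚ n ⬝ₚ m) := by
    have := mem_lam₂.1 (hH n)
    simp [inst] at this
    simpa [inst] using this.allE m
  -- The pairing serves twice: `(r k, s k)` codes a set index and a stage, and inside `approx` the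
  -- same functions code an element and a search step.
  let F : PTm [] (Ty.nat ⟶ₜ PN) := lam (approx (H.wk ⬝ₚ (r.wk ⬝ₚ v0)) r.wk s.wk (s.wk ⬝ₚ v0))
  have e (k : PTm [] Ty.nat) (w' : World) : w' ⊩ F ⬝ₚ k ≐ₚ approx (H ⬝ₚ (r ⬝ₚ k)) r s (s ⬝ₚ k) := by
    simpa [inst] using Pr.beta (w := w') (approx (H.wk ⬝ₚ (r.wk ⬝ₚ v0)) r.wk s.wk (s.wk ⬝ₚ v0)) k
  have hF (k : PTm [] Ty.nat) (w' : World) : w' ⊩ isFinite (F ⬝ₚ k) :=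
    isFinite_congr (e k w').symm (isFinite_approx _ _ _ _)
  have hI {k : PTm [] Ty.nat} {w' : World} : (w' ⊩ lam (U.wk ⬝ₚ (F.wk ⬝ₚ v0)) ⬝ₚ k) ↔ w' ⊩ U ⬝ₚ (F ⬝ₚ k) := by
    rw [Pr.mem_lam]; simp [inst]
  refine .exI (lam (U.wk ⬝ₚ (F.wk ⬝ₚ v0))) (.exI F ?_)
  simp only [inst, subst_and, subst_all, subst_imp, subst_iff, subst_ex, subst_inSigmaN, subst_subset,
    subst_isFinite, subst_app, subst_var_eq, lift_z, lift_s, one_z, wk_var, wk_subst_lift,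
    wk_subst_one]
  refine .andI (inSigmaN_lam _ fun k => ?_) (.andI (.allI fun k => ?_) (.allI fun S => ?_))
  · simpa [inst] using intrinsicOpen_apply hU (inSigmaN_of_isFinite (hF k w₃))
  · simp only [inst, subst_imp, subst_isFinite, subst_app, subst_var_eq, one_z, wk_subst_one]
    exact .impI fun w₄ _ _ => hF k w₄
  · simp only [inst, subst_and, subst_imp, subst_iff, subst_ex, subst_inSigmaN, subst_subset,
      subst_app, subst_var_eq, lift_z, lift_s, one_z, wk_subst_lift, wk_subst_one]
    refine .impI fun w₄ _ hS => .iffI (fun w₅ _ h => ((hsurj S).mp (w := w₅) hS.up).exE fun w₆ _ n hn => ?_)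
      fun w₅ _ h => h.exE fun w₆ _ k hk => ?_
    · simp [inst] at hn
      refine (exists_approx_mem (w := w₆) hU.up (fun a b => (hrs a b).up) (hW n).up
        (fun m => (hH n m).up) (Pr.mem_congr hn.symm h.up)).exE fun w₇ _ b hb =>
          (hrs n b).exE fun w₈ _ k hk => .exI k ?_
      simp [inst] at hb hk
      have e' : w₈ ⊩ F ⬝ₚ k ≐ₚ approx (H ⬝ₚ n) r s b := by
        have h₁ := Pr.congr (approx (H.wk ⬝ₚ v0) r.wk s.wk (s ⬝ₚ k).wk) hk.left
        have h₂ := Pr.congr (approx (H ⬝ₚ n).wk r.wk s.wk v0) hk.right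
        simp [inst] at h₁ h₂
        exact (e k w₈).trans (h₁.trans h₂)
      simp only [inst, subst_and, subst_subset, subst_app, subst_var_eq, one_z, wk_subst_one]
      exact .andI (hI.2 (Pr.mem_congr e'.symm hb.up)) (subset_congr e'.symm hn.up
        (approx_subset fun m => (hH n m).up))
    · simp only [inst, subst_and, subst_subset, subst_app, subst_var_eq, one_z, wk_subst_one] at hk
      exact intrinsicOpen_upper hU (inSigmaN_of_isFinite (hF k w₆)) hS.up (hI.1 hk.left) hk.right

/-- The sets `F n` are known to be finite only for `n ∈ I`, so the dependent form of closure under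
conjunction is what applies. -/
theorem intrinsicOpen_of_countableUnionOfBasic {U : PTm [] PPN} (h : w ⊩ countableUnionOfBasic U) :
    w ⊩ intrinsicOpen U := by
  refine h.exE fun w₁ _ I h => ?_
  simp [inst] at h
  refine h.exE fun w₂ _ F h => .allI fun S => ?_
  simp [inst] at h ⊢
  refine .impI fun w₃ _ hS => ?_
  have hSU := h.right.right.allE S
  simp [inst] at hSU
  refine inSigma_congr (hSU.mp hS).iff_symm (inSigma_ex _ fun n => ?_)
  simp [inst]
  refine inSigma_and (inSigmaN_apply h.left.up n) (.impI fun w₄ _ hn => ?_)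
  have hF := h.right.left.allE n
  simp [inst] at hF
  exact inSigma_subset (hF.mp hn) hS.up

theorem pr_intrinsicIsScott : w ⊩ intrinsicIsScott := .allI fun U => by
  simp [inst]
  exact .andI (.iffI (fun _ _ h => .andI h (.andI (isUpper_of_intrinsicOpen h)
      (inaccessible_of_intrinsicOpen h))) fun _ _ h => h.left)
    (.andI (.iffI (fun _ _ => countableUnionOfBasic_of_intrinsicOpen)
      fun _ _ => intrinsicOpen_of_countableUnionOfBasic)
      (.impI fun _ _ => unionOfItsBasic_of_intrinsicOpen))

end PTm

end SynthComp

theorem mainTheorem8 : SynthComp.Holds SynthComp.intrinsicIsScott :=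
  SynthComp.PTm.holds_of_pr SynthComp.PTm.pr_intrinsicIsScott
    SynthComp.PTm.intrinsicIsScott_close_nil
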